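/- Let $A$ be a closed annulus, $I=[0,1]$, and let $L\subset A\times I$ be a link. Let $D\subset A$ be a diagram of $L$ (the projection to $A$ of a generic link isotopic to $L$), and let $\gamma\subset A$ be an arc from the inner to the outer boundary circle that avoids the crossings of $D$ and meets $D$ transversely. Let $CKh(D)$ be the complex vector space with basis the enhanced Kauffman states of $D$: the choices of a smoothing ($0$ or $1$) of every crossing together with a sign $\pm$ on every circle of the resulting resolution. Let $\partial$ be Khovanov's differential: for every crossing of an enhanced state that is $0$-smoothed it changes the smoothing to the $1$-smoothing, with the usual sign (ordering the crossings, $-1$ to the number of earlier crossings that are $1$-smoothed), by the merge map $(+,+)\mapsto +$, $(+,-),(-,+)\mapsto -$, $(-,-)\mapsto 0$ or the split map $+\mapsto(+,-)+(-,+)$, $-\mapsto(-,-)$. The $k$-grading of an enhanced state is the sum of its signs ($\pm1$) over the nontrivial circles, i.e. those that are not contractible in $A$ (equivalently, those that meet $\gamma$ in an odd number of points). Write $\partial=\partial_0+\partial_-$, where $\partial_0$ preserves and $\partial_-$ decreases the $k$-grading. The sutured annular Khovanov homology is $SKh(L)=\ker\partial_0/\operatorname{im}\partial_0$, and $SKh(L;k)$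 denotes its summand of $k$-grading $k\in\mathbb Z$ (the homological and quantum gradings are summed over). Then $SKh(L)$ is trapezoidal with respect to the $k$-grading: for all integers $k,k'$ with $k\equiv k' \pmod 2$ and $|k|\le|k'|$, $$\dim_{\mathbb C} SKh(L;k)\ \ge\ \dim_{\mathbb C} SKh(L;k').$$ -/

import Mathlib

open scoped ContDiff

/-! ### Annular links -/

/-- Euclidean three-space. -/
abbrev E3 : Type := EuclideanSpace ℝ (Fin 3)

/-- The thickened annulus `A × I ⊂ ℝ³`: in cylindrical coordinates
`1 ≤ r ≤ 2`, `0 ≤ z ≤ 1`. -/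
def thickenedAnnulus : Set E3 :=
  {p | 1 ≤ p 0 ^ 2 + p 1 ^ 2 ∧ p 0 ^ 2 + p 1 ^ 2 ≤ 4 ∧ 0 ≤ p 2 ∧ p 2 ≤ 1}

/-- The complement of the `z`-axis in `ℝ³`. -/
abbrev AxisComplement : Type := {p : E3 // ¬ (p 0 = 0 ∧ p 1 = 0)}

/-- An (oriented) annular link: finitely many disjoint smoothly embedded closed curves in
`A × I`, given by 1-periodic regular parametrizations. -/
structure AnnularLink where
  /-- number of components -/
  numComponents : ℕ
  /-- the parametrized components -/
  curve : Fin numComponents → ℝ → E3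
  smooth : ∀ a, ContDiff ℝ ∞ (curve a)
  periodic : ∀ a, Function.Periodic (curve a) 1
  immersed : ∀ a s, deriv (curve a) s ≠ 0
  embedded : ∀ a b s t, curve a s = curve b t → a = b ∧ ∃ m : ℤ, s - t = m
  mem_thickenedAnnulus : ∀ a s, curve a s ∈ thickenedAnnulus

/-- The underlying point set of an annular link. -/
def AnnularLink.carrier (L : AnnularLink) : Set E3 :=
  ⋃ a, Set.range (L.curve a)

/-- Ambient isotopy of subsets of `ℝ³ ∖ z-axis`. -/
def AmbientIsotopic (K L : Set AxisComplement) : Prop :=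
  ∃ H : unitInterval → AxisComplement ≃ₜ AxisComplement,
    Continuous (fun q : unitInterval × AxisComplement => H q.1 q.2) ∧
    (∀ p, H 0 p = p) ∧ H 1 '' K = L

/-! ### Annular link diagrams

A diagram in the annulus is cut along a radial arc `γ` (at angle `0`) running from the inner to
the outer boundary, and is put in general position with respect to the angular coordinate: it is
then the annular closure of a stack of elementary slices, each of which contains exactly one
local extremum of the angle (a cup or a cap) or exactly one crossing, and otherwise strands going
through.  Strands are numbered from the inner boundary outwards, starting with `0`. In pictures,
the radius increases to the right and the angle increases upwards. -/

/-- The kinds of elementary slices. At a crossing of the strands `i` and `i + 1`, the rising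
strand leads from position `i` to `i + 1`, and the falling strand from `i + 1` to `i`. -/
inductive SliceKind
  /-- two new adjacent strands are born -/
  | cup
  /-- two adjacent strands are joined and end -/
  | cap
  /-- a crossing in which the rising strand is the over-strand -/
  | risingOver
  /-- a crossing in which the falling strand is the over-strand -/
  | fallingOver

/-- Whether a slice contains a crossing. -/
abbrev SliceKind.IsCrossing (K : SliceKind) : Prop :=
  K = .risingOver ∨ K = .fallingOver

/-- `k.Fits i n m`: the slice of kind `k`, with its cup, cap or crossing at the positions
`i` and `i + 1`, has `n` lower and `m` upper end points. -/
def SliceKind.Fits : SliceKind → ℕ → ℕ → ℕ → Prop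
  | .cup, i, n, m => i ≤ n ∧ m = n + 2
  | .cap, i, n, m => i ≤ m ∧ n = m + 2
  | .risingOver, i, n, m => i + 2 ≤ n ∧ m = n
  | .fallingOver, i, n, m => i + 2 ≤ n ∧ m = n

theorem SliceKind.fits_crossing (K : SliceKind) (hK : K.IsCrossing) {i n m : ℕ}
    (h : K.Fits i n m) : i + 2 ≤ n ∧ m = n := by
  rcases hK with rfl | rfl <;> exact h

/-- An annular link diagram, as the closure of a stack of `len` elementary slices. The slice
`t` lies between the levels `t` and `t + 1`; the level `len` is joined to the level `0` by
parallel strands. -/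
structure AnnularDiagram where
  len : ℕ
  /-- number of strands at each level -/
  width : Fin (len + 1) → ℕ
  kind : Fin len → SliceKind
  /-- position of the cup, cap or crossing -/
  pos : Fin len → ℕ
  fits : ∀ t : Fin len, (kind t).Fits (pos t) (width t.castSucc) (width t.succ)
  closed : width (Fin.last len) = width 0

/-! ### Links presented by a diagram -/

/-- The strands of a slice with `n` lower end points at the intermediate time `u ∈ [0, 1]`:
there is a strand at the (real) position `x` and at the height `z`. -/
def SliceKind.StrandAt (i n : ℕ) (u x z : ℝ) : SliceKind → Prop
  | .cup => z = 1 / 2 ∧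
      ((∃ j < n, (j < i ∧ x = j) ∨ (i ≤ j ∧ x = j + 2 * u)) ∨
        (1 / 2 ≤ u ∧ (x = i + u ∨ x = i + 1 - u)))
  | .cap => z = 1 / 2 ∧
      ((∃ j < n, (j < i ∧ x = j) ∨ (i + 2 ≤ j ∧ x = j - 2 * u)) ∨
        (u ≤ 1 / 2 ∧ (x = i + u ∨ x = i + 1 - u)))
  | .risingOver =>
      (∃ j < n, j ≠ i ∧ j ≠ i + 1 ∧ x = j ∧ z = 1 / 2) ∨
        (x = i + u ∧ z = 1 / 2 + u * (1 - u)) ∨ (x = i + 1 - u ∧ z = 1 / 2)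
  | .fallingOver =>
      (∃ j < n, j ≠ i ∧ j ≠ i + 1 ∧ x = j ∧ z = 1 / 2) ∨
        (x = i + u ∧ z = 1 / 2) ∨ (x = i + 1 - u ∧ z = 1 / 2 + u * (1 - u))

namespace AnnularDiagram

variable (D : AnnularDiagram)

/-- The point of `A × I` at the (real) level `y`, position `x` and height `z`: the angle is
proportional to the level, and the positions are rescaled to fit into the annulus. -/
noncomputable def place (y x z : ℝ) : E3 :=
  let θ : ℝ := 2 * Real.pi * (y / (D.len + 1))
  let r : ℝ := 1 + (x + 1) / ((∑ t, D.width t : ℕ) + 1)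
  !₂[r * Real.cos θ, r * Real.sin θ, z]

/-- The link in `A × I` described by the diagram: its projection is the diagram, and at each
crossing the over-strand is pushed upwards. -/
def realization : Set E3 :=
  {p | (∃ t : Fin D.len, ∃ u ∈ Set.Icc (0 : ℝ) 1, ∃ x z : ℝ,
          (D.kind t).StrandAt (D.pos t) (D.width t.castSucc) u x z ∧
            p = D.place ((t : ℕ) + u) x z) ∨
       (∃ u ∈ Set.Icc (0 : ℝ) 1, ∃ j < D.width 0, p = D.place (D.len + u) (j : ℕ) (1 / 2))}

/-- `D` is a diagram of the annular link `L`: the link described by `D` is isotopic to `L` in the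
complement of the `z`-axis. -/
def IsDiagramOf (L : AnnularLink) : Prop :=
  AmbientIsotopic (Subtype.val ⁻¹' D.realization) (Subtype.val ⁻¹' L.carrier)

/-! ### Kauffman states -/

/-- The points of the diagram on the level lines: a level together with a strand position. -/
abbrev Point : Type := Σ t : Fin (D.len + 1), Fin (D.width t)

/-- The crossings of the diagram (each is named by the slice that contains it). -/
abbrev Crossing : Type := {t : Fin D.len // (D.kind t).IsCrossing}

/-- The vertices of the cube of resolutions: `false` stands for the 0-smoothing and `true` for
the 1-smoothing of a crossing. -/
abbrev CubeVertex : Type := D.Crossing → Bool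

end AnnularDiagram

/-- The crossingless slices that appear in resolutions of a diagram. -/
inductive FlatKind
  | cup
  | cap
  /-- only strands going through -/
  | through
  /-- a cap followed by a cup at the same position -/
  | turnback

/-- Lower end points `j` and `j'` of the flat slice are joined by an arc. -/
def FlatKind.LowerArc (i j j' : ℕ) : FlatKind → Prop
  | .cup => False
  | .cap => j = i ∧ j' = i + 1
  | .through => False
  | .turnback => j = i ∧ j' = i + 1

/-- Upper end points `j` and `j'` of the flat slice are joined by an arc. -/
def FlatKind.UpperArc (i j j' : ℕ) : FlatKind → Prop
  | .cup => j = i ∧ j' = i + 1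
  | .cap => False
  | .through => False
  | .turnback => j = i ∧ j' = i + 1

/-- The lower end point `j` and the upper end point `j'` of the flat slice are joined by a
strand. -/
def FlatKind.Strand (i j j' : ℕ) : FlatKind → Prop
  | .cup => (j < i ∧ j' = j) ∨ (i ≤ j ∧ j' = j + 2)
  | .cap => (j < i ∧ j' = j) ∨ (i ≤ j' ∧ j = j' + 2)
  | .through => j' = j
  | .turnback => j ≠ i ∧ j ≠ i + 1 ∧ j' = j

namespace AnnularDiagram

variable (D : AnnularDiagram)

/-- The slice `t` in the resolution `s`. The 0-smoothing of a crossing joins the two regions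
swept out by turning the over-strand counterclockwise until it meets the under-strand. -/
def smoothing (s : D.CubeVertex) (t : Fin D.len) : FlatKind :=
  match h : D.kind t with
  | .cup => .cup
  | .cap => .cap
  | .risingOver =>
      match s ⟨t, Or.inl h⟩ with
      | false => .through
      | true => .turnback
  | .fallingOver =>
      match s ⟨t, Or.inr h⟩ with
      | false => .turnback
      | true => .through

/-- Two points are joined by an arc of the resolution `s` between consecutive level lines. -/
inductive Joined (s : D.CubeVertex) : D.Point → D.Point → Prop
  | lower (t : Fin D.len) (j j' : Fin (D.width t.castSucc))
      (h : (D.smoothing s t).LowerArc (D.pos t) j j') :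
      Joined s ⟨t.castSucc, j⟩ ⟨t.castSucc, j'⟩
  | upper (t : Fin D.len) (j j' : Fin (D.width t.succ))
      (h : (D.smoothing s t).UpperArc (D.pos t) j j') :
      Joined s ⟨t.succ, j⟩ ⟨t.succ, j'⟩
  | strand (t : Fin D.len) (j : Fin (D.width t.castSucc)) (j' : Fin (D.width t.succ))
      (h : (D.smoothing s t).Strand (D.pos t) j j') :
      Joined s ⟨t.castSucc, j⟩ ⟨t.succ, j'⟩
  | closure (j : Fin (D.width (Fin.last D.len))) (j' : Fin (D.width 0))
      (h : (j : ℕ) = j') :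
      Joined s ⟨Fin.last D.len, j⟩ ⟨0, j'⟩

/-- The circles of the resolution `s`: the classes of points under the equivalence relation
generated by `Joined`. -/
abbrev StateCircle (s : D.CubeVertex) : Type := Quot (D.Joined s)

/-- A circle of a resolution is nontrivial (that is, not contractible in the annulus) if and only
if it meets the arc `γ`, at the level `0`, in an odd number of points. -/
def Nontrivial (s : D.CubeVertex) (C : D.StateCircle s) : Prop :=
  Odd (Nat.card {j : Fin (D.width 0) // (Quot.mk _ ⟨0, j⟩ : D.StateCircle s) = C})

/-- Enhanced (or oriented) Kauffman states: a resolution with a sign on each of its circles;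
`true` stands for `+` and `false` for `-`. -/
abbrev EnhancedState : Type := Σ s : D.CubeVertex, D.StateCircle s → Bool

noncomputable instance instFintypeCrossing : Fintype D.Crossing := Fintype.ofFinite _

noncomputable instance instFintypeStateCircle (s : D.CubeVertex) : Fintype (D.StateCircle s) :=
  Fintype.ofFinite _

noncomputable instance instFintypeEnhancedState : Fintype D.EnhancedState := Fintype.ofFinite _

variable {D}

/-- The sign with which an enhanced state labels the circle through a point. -/
def EnhancedState.label (S : D.EnhancedState) (p : D.Point) : Bool := S.2 (Quot.mk _ p)

open Classical in
/-- The `k`-grading: each nontrivial circle contributes `1` or `-1` according to its sign, and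
trivial circles do not contribute. -/
noncomputable def EnhancedState.kGrading (S : D.EnhancedState) : ℤ :=
  ∑ C : D.StateCircle S.1, if D.Nontrivial S.1 C then (if S.2 C then 1 else -1) else 0

/-! ### The Khovanov complex and sutured annular Khovanov homology -/

/-- The inner lower corner of a crossing. -/
def Crossing.corner (c : D.Crossing) : D.Point :=
  ⟨c.1.castSucc, D.pos c.1, by
    have h := (D.kind c.1).fits_crossing c.2 (D.fits c.1)
    omega⟩

/-- The outer upper corner of a crossing. Both smoothings of the crossing consist of two arcs, one
of which ends in `c.corner` and the other one in `c.oppositeCorner`. -/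
def Crossing.oppositeCorner (c : D.Crossing) : D.Point :=
  ⟨c.1.succ, D.pos c.1 + 1, by
    have h := (D.kind c.1).fits_crossing c.2 (D.fits c.1)
    omega⟩

end AnnularDiagram

/-- Structure constants of the merge map: `(+,+) ↦ +`, `(+,-) ↦ -`, `(-,+) ↦ -`,
`(-,-) ↦ 0`. -/
def mergeCoeff : Bool → Bool → Bool → ℂ
  | true, true, true => 1
  | true, false, false => 1
  | false, true, false => 1
  | _, _, _ => 0

/-- Structure constants of the split map: `+ ↦ (+,-) + (-,+)`, `- ↦ (-,-)`. -/
def splitCoeff : Bool → Bool → Bool → ℂ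
  | true, true, false => 1
  | true, false, true => 1
  | false, false, false => 1
  | _, _, _ => 0

namespace AnnularDiagram

variable {D : AnnularDiagram}

open Classical in
/-- The coefficient of `S'` in the image of `S` under the merge or split map at the crossing `c`,
where the resolution of `S'` arises from that of `S` by changing `c` from the 0-smoothing to the
1-smoothing. The circles of `S` that do not run through `c` keep their signs. -/
noncomputable def saddleCoeff (c : D.Crossing) (S S' : D.EnhancedState) : ℂ :=
  let P : D.StateCircle S.1 := Quot.mk _ c.corner
  let Q : D.StateCircle S.1 := Quot.mk _ c.oppositeCorner
  if ∀ p : D.Point, (Quot.mk _ p : D.StateCircle S.1) ≠ P →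
      (Quot.mk _ p : D.StateCircle S.1) ≠ Q → S'.label p = S.label p then
    if P = Q then
      splitCoeff (S.label c.corner) (S'.label c.corner) (S'.label c.oppositeCorner)
    else
      mergeCoeff (S.label c.corner) (S.label c.oppositeCorner) (S'.label c.corner)
  else 0

open Classical in
/-- The coefficient of `S'` in the Khovanov differential of `S`, with the standard sign that
depends on the number of earlier 1-smoothings. -/
noncomputable def khovanovCoeff (S S' : D.EnhancedState) : ℂ :=
  ∑ c : D.Crossing,
    if S.1 c = false ∧ S'.1 = Function.update S.1 c true then
      (-1) ^ (Nat.card {b : D.Crossing // b < c ∧ S.1 b = true}) * saddleCoeff c S S'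
    else 0

variable (D)

/-- The chain space `CKh`, with the enhanced states as basis. -/
abbrev CKh : Type := D.EnhancedState → ℂ

open Classical in
/-- The sutured differential `∂₀`: the part of the Khovanov differential `∂` (with
the matrix `khovanovCoeff`) that preserves the `k`-grading. -/
noncomputable def suturedDifferential : D.CKh →ₗ[ℂ] D.CKh :=
  Matrix.mulVecLin (Matrix.of fun S' S =>
    if S'.kGrading = S.kGrading then khovanovCoeff S S' else 0)

/-- Sutured annular Khovanov homology: cycles modulo boundaries of `(CKh, ∂₀)`. -/
abbrev SKh : Type :=
  LinearMap.ker D.suturedDifferential ⧸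
    (LinearMap.range D.suturedDifferential).comap (LinearMap.ker D.suturedDifferential).subtype

/-- The chains of `k`-grading `k`. -/
def chainsOfWeight (k : ℤ) : Submodule ℂ D.CKh where
  carrier := {x | ∀ S, x S ≠ 0 → S.kGrading = k}
  zero_mem' := by intro S h; simp at h
  add_mem' := by
    intro x y hx hy S h
    by_cases hxS : x S = 0
    · exact hy S (by simpa [hxS] using h)
    · exact hx S hxS
  smul_mem' := by
    intro a x hx S h
    exact hx S (by intro h0; simp [h0] at h)

/-- The summand `SKh(L; k)` of `SKh(L)`: the homology classes of cycles of `k`-grading `k`. -/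
noncomputable def SKhOfWeight (k : ℤ) : Submodule ℂ D.SKh :=
  ((D.chainsOfWeight k).comap (LinearMap.ker D.suturedDifferential).subtype).map
    (Submodule.mkQ _)

end AnnularDiagram

/-!
Sutured annular Khovanov homology carries an action of `sl₂` for which the `k`-grading is the weight
grading, and the dimensions of the weight spaces of a finite-dimensional representation of `sl₂`
are trapezoidal.

Orient the strands of a resolution upwards at even positions and downwards at odd ones. All arcs of
all resolutions respect this checkerboard orientation (`AnnularDiagram.Flow`), so the circles of a
resolution are the cycles of a permutation of the points, and a crossing change multiplies this
permutation with a transposition. Hence a crossing change merges two circles or splits one in two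
(`IsEdge.mk_corner_eq_iff`), and does not affect the others. Moreover every circle `C` has a winding
number `w C`, which is additive under merges and splits. Along a circle, the number of points below
it that lie on other circles has constant parity; therefore the signs with which a circle meets the
level `0` alternate, so that `w C` is `±1` for nontrivial circles and `0` for trivial ones
(`AnnularDiagram.winding_eq`).

In the Frobenius algebra `ℂ[x]/(x²)` with `v₊ = 1`, `v₋ = x`, let the lowering operator be the
multiplication with `∑ w C • x_C`. Since `w` is additive, and since merges and splits are linear
over multiplication by `x`, it commutes with the full Khovanov differential; since it lowers the
`k`-grading by exactly `2`, it also commutes with the part `∂₀` of the differential that preserves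
the `k`-grading (`ladderMap_false_suturedDifferential`). Reversing the signs of all nontrivial
circles is a chain map for `∂₀` (`reverseMap_suturedDifferential`), and conjugates the lowering
operator to the raising operator. Because of `w C ^ 2 = 1` for nontrivial circles, the commutator of
the two is the `k`-grading (`ladderMap_commutator`).

On homology, the lowering operator is injective in positive weights, as a vector of weight `k` in
its kernel is a primitive vector of weight `-k` for the opposite `sl₂`-triple; and the reversal of
signs identifies the weight spaces of `k` and `-k`.
-/

/-! ### Cycles of permutations and transpositions -/

namespace Equiv.Perm

variable {α : Type*}

/-- A set that is mapped into itself by a permutation of a finite type is a union of cycles. -/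
theorem SameCycle.mem_of_mapsTo [Finite α] {σ : Perm α} {T : Set α}
    (hT : Set.MapsTo σ T T) {x y : α}
    (h : σ.SameCycle x y) (hx : x ∈ T) : y ∈ T := by
  obtain ⟨n, rfl⟩ := h.exists_nat_pow_eq
  induction n with
  | zero => simpa using hx
  | succ n ih =>
    rw [pow_succ', mul_apply]
    exact hT (ih ⟨n, by simp⟩)

variable [DecidableEq α] {σ : Perm α} {a e : α}

theorem mul_swap_apply_of_ne {x : α} (ha : x ≠ a) (he : x ≠ e) : (σ * swap a e) x = σ x := by
  rw [mul_apply, swap_apply_of_ne_of_ne ha he]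

variable [Finite α]

/-- Multiplication with a transposition does not affect the cycles that avoid it. -/
theorem sameCycle_mul_swap_of_not_sameCycle {p q : α} (ha : ¬ σ.SameCycle p a)
    (he : ¬ σ.SameCycle p e) (h : σ.SameCycle p q) : (σ * swap a e).SameCycle p q := by
  refine (h.mem_of_mapsTo (T := {x | σ.SameCycle p x ∧ (σ * swap a e).SameCycle p x}) ?_
    ⟨SameCycle.rfl, SameCycle.rfl⟩).2
  rintro x ⟨h1, h2⟩
  have hx : (σ * swap a e) x = σ x :=
    mul_swap_apply_of_ne (fun h => ha (h ▸ h1)) (fun h => he (h ▸ h1))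
  refine ⟨sameCycle_apply_right.2 h1, ?_⟩
  rw [← hx]
  exact sameCycle_apply_right.2 h2

theorem sameCycle_of_sameCycle_mul_swap {p q : α} (ha : ¬ σ.SameCycle p a)
    (he : ¬ σ.SameCycle p e) (h : (σ * swap a e).SameCycle p q) : σ.SameCycle p q := by
  refine h.mem_of_mapsTo (T := {x | σ.SameCycle p x}) ?_ SameCycle.rfl
  intro x h1
  have hx : (σ * swap a e) x = σ x :=
    mul_swap_apply_of_ne (fun h => ha (h ▸ h1)) (fun h => he (h ▸ h1))
  rw [hx]
  exact sameCycle_apply_right.2 h1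

/-- Multiplication with a transposition merges the cycles of two points in different cycles. -/
theorem sameCycle_mul_swap_of_not (h : ¬ σ.SameCycle a e) : (σ * swap a e).SameCycle a e := by
  by_contra hτ
  have hmem : a ∈ {x | (σ * swap a e).SameCycle e x ∧ σ.SameCycle a x} := by
    refine SameCycle.mem_of_mapsTo (σ := σ) (x := σ a) ?_ (sameCycle_apply_left.2 SameCycle.rfl) ?_
    · rintro x ⟨h1, h2⟩
      have hx : (σ * swap a e) x = σ x :=
        mul_swap_apply_of_ne (fun h => hτ (h ▸ h1).symm) (fun h' => h (h' ▸ h2))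
      refine ⟨?_, sameCycle_apply_right.2 h2⟩
      rw [← hx]
      exact sameCycle_apply_right.2 h1
    · refine ⟨?_, sameCycle_apply_right.2 SameCycle.rfl⟩
      have : (σ * swap a e) e = σ a := by simp
      rw [← this]
      exact sameCycle_apply_right.2 SameCycle.rfl
  exact hτ hmem.1.symm

/-- Multiplication with a transposition of two different points in the same cycle splits it. -/
theorem not_sameCycle_mul_swap (hne : a ≠ e) (h : σ.SameCycle a e) :
    ¬ (σ * swap a e).SameCycle a e := by
  classical
  intro hτ
  have hex : ∃ n, (σ ^ n) a = e := h.exists_nat_pow_eq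
  set n := Nat.find hex with hn
  have hne' : (σ ^ n) a = e := Nat.find_spec hex
  have hmin : ∀ m < n, (σ ^ m) a ≠ e := fun m hm => Nat.find_min hex hm
  have hpos : 0 < n := by
    rcases Nat.eq_zero_or_pos n with h0 | h0
    · rw [h0] at hne'
      exact absurd hne' (by simpa using hne)
    · exact h0
  -- by minimality of `n`, the points `σ a, …, σⁿ a = e` are different from `a`
  have hna : ∀ m, 0 < m → m ≤ n → (σ ^ m) a ≠ a := by
    intro m hm hmn hma
    refine hmin (n - m) (by omega) ?_
    have : (σ ^ n) a = (σ ^ (n - m)) ((σ ^ m) a) := by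
      rw [← mul_apply, ← pow_add, Nat.sub_add_cancel hmn]
    rw [← hne', this, hma]
  have hmem : a ∈ {x | ∃ m, 0 < m ∧ m ≤ n ∧ (σ ^ m) a = x} := by
    refine hτ.symm.mem_of_mapsTo ?_ ⟨n, hpos, le_rfl, hne'⟩
    rintro x ⟨m, hm, hmn, rfl⟩
    rcases hmn.eq_or_lt with rfl | hlt
    · refine ⟨1, one_pos, hpos, ?_⟩
      rw [hne']
      simp
    · refine ⟨m + 1, by omega, hlt, ?_⟩
      rw [mul_swap_apply_of_ne (hna m hm hmn) (hmin m hlt), pow_succ', mul_apply]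
  obtain ⟨m, hm, hmn, hma⟩ := hmem
  exact hna m hm hmn hma

end Equiv.Perm

/-! ### Flat slices and the checkerboard orientation -/

namespace AnnularDiagram

variable {D : AnnularDiagram}

theorem Point.ext_val {p q : D.Point} (h1 : (p.1 : ℕ) = q.1) (h2 : (p.2 : ℕ) = q.2) : p = q := by
  obtain ⟨t, j⟩ := p
  obtain ⟨t', j'⟩ := q
  obtain rfl : t = t' := Fin.ext h1
  obtain rfl : j = j' := Fin.ext h2
  rfl

theorem smoothing_crossing (s : D.CubeVertex) (c : D.Crossing) :
    (D.kind c.1 = .risingOver ∧ D.smoothing s c.1 = if s c then .turnback else .through) ∨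
    (D.kind c.1 = .fallingOver ∧ D.smoothing s c.1 = if s c then .through else .turnback) := by
  obtain ⟨t, ht⟩ := c
  rcases ht with h | h
  · refine Or.inl ⟨h, ?_⟩
    unfold smoothing
    split <;> rename_i h' <;> first | (cases h.symm.trans h'; done) | skip
    cases s ⟨t, Or.inl h⟩ <;> rfl
  · refine Or.inr ⟨h, ?_⟩
    unfold smoothing
    split <;> rename_i h' <;> first | (cases h.symm.trans h'; done) | skip
    cases s ⟨t, Or.inr h⟩ <;> rfl

theorem smoothing_congr {s s' : D.CubeVertex} {t : Fin D.len}
    (h : ∀ ht, s ⟨t, ht⟩ = s' ⟨t, ht⟩) : D.smoothing s t = D.smoothing s' t := by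
  unfold smoothing
  split
  · rfl
  · rfl
  · rename_i h'
    rw [h (Or.inl h')]
  · rename_i h'
    rw [h (Or.inr h')]

/-- The end points of a flat slice. -/
def _root_.FlatKind.Fits : FlatKind → ℕ → ℕ → ℕ → Prop
  | .cup, i, n, m => i ≤ n ∧ m = n + 2
  | .cap, i, n, m => i ≤ m ∧ n = m + 2
  | .through, _, n, m => m = n
  | .turnback, i, n, m => i + 2 ≤ n ∧ m = n

theorem smoothing_fits (s : D.CubeVertex) (t : Fin D.len) :
    (D.smoothing s t).Fits (D.pos t) (D.width t.castSucc) (D.width t.succ) := by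
  have hf := D.fits t
  unfold smoothing
  split <;> rename_i h <;> rw [h] at hf <;> simp only [SliceKind.Fits] at hf
  · exact hf
  · exact hf
  · split <;> simp [FlatKind.Fits, hf]
  · split <;> simp [FlatKind.Fits, hf]

end AnnularDiagram

namespace AnnularDiagram

variable {D : AnnularDiagram}

/-- The checkerboard orientation of a resolution: `Flow s p q` says that an arc of the resolution
`s` leads from `p` to `q`, where strands at even positions are oriented upwards and those at odd
positions downwards. Both smoothings of every crossing respect this orientation. -/
def Flow (s : D.CubeVertex) (p q : D.Point) : Prop :=
  (∃ t : Fin D.len, (p.1 : ℕ) = t ∧ (q.1 : ℕ) = t + 1 ∧ Even (q.2 : ℕ) ∧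
    (D.smoothing s t).Strand (D.pos t) p.2 q.2) ∨
  (∃ t : Fin D.len, (q.1 : ℕ) = t ∧ (p.1 : ℕ) = t + 1 ∧ Odd (q.2 : ℕ) ∧
    (D.smoothing s t).Strand (D.pos t) q.2 p.2) ∨
  (∃ t : Fin D.len, (p.1 : ℕ) = t ∧ (q.1 : ℕ) = t ∧ Odd (q.2 : ℕ) ∧
    ((D.smoothing s t).LowerArc (D.pos t) p.2 q.2 ∨
      (D.smoothing s t).LowerArc (D.pos t) q.2 p.2)) ∨
  (∃ t : Fin D.len, (p.1 : ℕ) = t + 1 ∧ (q.1 : ℕ) = t + 1 ∧ Even (q.2 : ℕ) ∧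
    ((D.smoothing s t).UpperArc (D.pos t) p.2 q.2 ∨
      (D.smoothing s t).UpperArc (D.pos t) q.2 p.2)) ∨
  ((p.1 : ℕ) = D.len ∧ (q.1 : ℕ) = 0 ∧ Even (q.2 : ℕ) ∧ (p.2 : ℕ) = q.2) ∨
  ((q.1 : ℕ) = D.len ∧ (p.1 : ℕ) = 0 ∧ Odd (q.2 : ℕ) ∧ (p.2 : ℕ) = q.2)

theorem exists_flow (s : D.CubeVertex) (p : D.Point) : ∃ q, Flow s p q := by
  obtain ⟨τ, j, hj⟩ := p
  rcases Nat.even_or_odd j with he | ho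
  · induction τ using Fin.lastCases with
    | last =>
      exact ⟨⟨0, j, D.closed ▸ hj⟩, Or.inr <| Or.inr <| Or.inr <| Or.inr <| Or.inl
        ⟨by simp, by simp, he, rfl⟩⟩
    | cast t =>
      have hf := smoothing_fits s t
      have up : ∀ j', (D.smoothing s t).Strand (D.pos t) j j' → j' < D.width t.succ → Even j' →
          ∃ q, Flow s ⟨t.castSucc, j, hj⟩ q := fun j' h h' he' =>
        ⟨⟨t.succ, j', h'⟩, Or.inl ⟨t, by simp, by simp, he', h⟩⟩
      have turn : ∀ j', ((D.smoothing s t).LowerArc (D.pos t) j j' ∨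
          (D.smoothing s t).LowerArc (D.pos t) j' j) → j' < D.width t.castSucc → Odd j' →
          ∃ q, Flow s ⟨t.castSucc, j, hj⟩ q := fun j' h h' he' =>
        ⟨⟨t.castSucc, j', h'⟩, Or.inr <| Or.inr <| Or.inl ⟨t, by simp, by simp, he', h⟩⟩
      cases hk : D.smoothing s t <;> rw [hk] at hf up turn <;>
        simp only [FlatKind.Fits, FlatKind.Strand, FlatKind.LowerArc] at hf up turn
      · rcases lt_or_ge j (D.pos t) with h | h
        · exact up j (by omega) (by omega) (by grind)
        · exact up (j + 2) (by omega) (by omega) (by grind)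
      · rcases lt_or_ge j (D.pos t) with h | h
        · exact up j (by omega) (by omega) (by grind)
        · rcases eq_or_ne j (D.pos t) with h1 | h1
          · exact turn (j + 1) (by omega) (by omega) (by grind)
          · rcases eq_or_ne j (D.pos t + 1) with h2 | h2
            · exact turn (j - 1) (by omega) (by omega) (by grind)
            · exact up (j - 2) (by omega) (by omega) (by grind)
      · exact up j rfl (by omega) (by grind)
      · rcases eq_or_ne j (D.pos t) with h1 | h1
        · exact turn (j + 1) (by omega) (by omega) (by grind)
        · rcases eq_or_ne j (D.pos t + 1) with h2 | h2
          · exact turn (j - 1) (by omega) (by omega) (by grind)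
          · exact up j (by omega) (by omega) (by grind)
  · induction τ using Fin.cases with
    | zero =>
      exact ⟨⟨Fin.last _, j, D.closed ▸ hj⟩, Or.inr <| Or.inr <| Or.inr <| Or.inr <| Or.inr
        ⟨by simp, by simp, ho, rfl⟩⟩
    | succ t =>
      have hf := smoothing_fits s t
      have down : ∀ j', (D.smoothing s t).Strand (D.pos t) j' j → j' < D.width t.castSucc →
          Odd j' → ∃ q, Flow s ⟨t.succ, j, hj⟩ q := fun j' h h' ho' =>
        ⟨⟨t.castSucc, j', h'⟩, Or.inr <| Or.inl ⟨t, by simp, by simp, ho', h⟩⟩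
      have turn : ∀ j', ((D.smoothing s t).UpperArc (D.pos t) j j' ∨
          (D.smoothing s t).UpperArc (D.pos t) j' j) → j' < D.width t.succ → Even j' →
          ∃ q, Flow s ⟨t.succ, j, hj⟩ q := fun j' h h' he' =>
        ⟨⟨t.succ, j', h'⟩, Or.inr <| Or.inr <| Or.inr <| Or.inl ⟨t, by simp, by simp, he', h⟩⟩
      cases hk : D.smoothing s t <;> rw [hk] at hf down turn <;>
        simp only [FlatKind.Fits, FlatKind.Strand, FlatKind.UpperArc] at hf down turn
      · rcases lt_or_ge j (D.pos t) with h | h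
        · exact down j (by omega) (by omega) ho
        · rcases eq_or_ne j (D.pos t) with h1 | h1
          · exact turn (j + 1) (by omega) (by omega) (by grind)
          · rcases eq_or_ne j (D.pos t + 1) with h2 | h2
            · exact turn (j - 1) (by omega) (by omega) (by grind)
            · exact down (j - 2) (by omega) (by omega) (by grind)
      · rcases lt_or_ge j (D.pos t) with h | h
        · exact down j (by omega) (by omega) ho
        · exact down (j + 2) (by omega) (by omega) (by grind)
      · exact down j rfl (by omega) ho
      · rcases eq_or_ne j (D.pos t) with h1 | h1
        · exact turn (j + 1) (by omega) (by omega) (by grind)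
        · rcases eq_or_ne j (D.pos t + 1) with h2 | h2
          · exact turn (j - 1) (by omega) (by omega) (by grind)
          · exact down j (by omega) (by omega) ho

theorem Flow.left_unique {s : D.CubeVertex} {p p' q : D.Point} (h : Flow s p q)
    (h' : Flow s p' q) : p = p' := by
  have key : (p.1 : ℕ) = p'.1 ∧ (p.2 : ℕ) = p'.2 := by
    rcases h with ⟨t, h1, h2, h3, h4⟩ | ⟨t, h1, h2, h3, h4⟩ | ⟨t, h1, h2, h3, h4⟩ |
      ⟨t, h1, h2, h3, h4⟩ | ⟨h1, h2, h3, h4⟩ | ⟨h1, h2, h3, h4⟩ <;>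
    rcases h' with ⟨t', h1', h2', h3', h4'⟩ | ⟨t', h1', h2', h3', h4'⟩ | ⟨t', h1', h2', h3', h4'⟩ |
      ⟨t', h1', h2', h3', h4'⟩ | ⟨h1', h2', h3', h4'⟩ | ⟨h1', h2', h3', h4'⟩ <;>
    simp only [Nat.even_iff, Nat.odd_iff] at h3 h3' <;>
    first
    | omega
    | obtain rfl : t = t' := Fin.ext (by omega)
      cases hk : D.smoothing s t <;> rw [hk] at h4 h4' <;>
        simp only [FlatKind.Strand, FlatKind.LowerArc, FlatKind.UpperArc,
          or_false] at h4 h4' <;> omega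
  exact Point.ext_val key.1 key.2

end AnnularDiagram

/-! ### The circles of a resolution as cycles of a permutation -/

namespace AnnularDiagram

variable {D : AnnularDiagram}

/-- The permutation of the points of a diagram that follows the oriented arcs of a resolution. -/
noncomputable def flowPerm (s : D.CubeVertex) : Equiv.Perm D.Point :=
  Equiv.ofBijective (fun p => (exists_flow s p).choose) <| Finite.injective_iff_bijective.1
    fun p p' h => (exists_flow s p).choose_spec.left_unique <| by
      have := (exists_flow s p').choose_spec
      rwa [← show (exists_flow s p).choose = _ from h] at this

theorem flow_flowPerm (s : D.CubeVertex) (p : D.Point) : Flow s p (flowPerm s p) :=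
  (exists_flow s p).choose_spec

theorem flow_iff {s : D.CubeVertex} {p q : D.Point} : Flow s p q ↔ flowPerm s p = q := by
  refine ⟨fun h => ?_, fun h => h ▸ flow_flowPerm s p⟩
  obtain ⟨p', rfl⟩ := (flowPerm s).surjective q
  rw [h.left_unique (flow_flowPerm s p')]

theorem Joined.flow {s : D.CubeVertex} {p q : D.Point} (h : D.Joined s p q) :
    Flow s p q ∨ Flow s q p := by
  cases h with
  | lower t j j' h =>
    have h1 : (j' : ℕ) = j + 1 := by
      cases hk : D.smoothing s t <;> rw [hk] at h <;> simp only [FlatKind.LowerArc] at h <;> omega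
    rcases Nat.even_or_odd j' with hp | hp
    · exact Or.inr <| Or.inr <| Or.inr <| Or.inl ⟨t, by simp, by simp, by grind, Or.inr h⟩
    · exact Or.inl <| Or.inr <| Or.inr <| Or.inl ⟨t, by simp, by simp, hp, Or.inl h⟩
  | upper t j j' h =>
    have h1 : (j' : ℕ) = j + 1 := by
      cases hk : D.smoothing s t <;> rw [hk] at h <;> simp only [FlatKind.UpperArc] at h <;> omega
    rcases Nat.even_or_odd j' with hp | hp
    · exact Or.inl <| Or.inr <| Or.inr <| Or.inr <| Or.inl ⟨t, by simp, by simp, hp, Or.inl h⟩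
    · exact Or.inr <| Or.inr <| Or.inr <| Or.inr <| Or.inl
        ⟨t, by simp, by simp, by grind, Or.inr h⟩
  | strand t j j' h =>
    have h1 : (j' : ℕ) % 2 = j % 2 := by
      cases hk : D.smoothing s t <;> rw [hk] at h <;> simp only [FlatKind.Strand] at h <;> omega
    rcases Nat.even_or_odd j' with hp | hp
    · exact Or.inl <| Or.inl ⟨t, by simp, by simp, hp, h⟩
    · exact Or.inr <| Or.inr <| Or.inl ⟨t, by simp, by simp, by grind, h⟩
  | closure j j' h =>
    rcases Nat.even_or_odd j' with hp | hp
    · exact Or.inl <| Or.inr <| Or.inr <| Or.inr <| Or.inr <| Or.inl ⟨by simp, by simp, hp, h⟩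
    · exact Or.inr <| Or.inr <| Or.inr <| Or.inr <| Or.inr <| Or.inr
        ⟨by simp, by simp, by grind, h.symm⟩

theorem Flow.mk_eq {s : D.CubeVertex} {p q : D.Point} (h : Flow s p q) :
    (Quot.mk _ p : D.StateCircle s) = Quot.mk _ q := by
  obtain ⟨τ, j⟩ := p
  obtain ⟨τ', j'⟩ := q
  rcases h with ⟨t, h1, h2, h3, h4⟩ | ⟨t, h1, h2, h3, h4⟩ | ⟨t, h1, h2, h3, h4⟩ |
    ⟨t, h1, h2, h3, h4⟩ | ⟨h1, h2, h3, h4⟩ | ⟨h1, h2, h3, h4⟩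
  · obtain rfl : τ = t.castSucc := Fin.ext h1
    obtain rfl : τ' = t.succ := Fin.ext h2
    exact Quot.sound (.strand t j j' h4)
  · obtain rfl : τ' = t.castSucc := Fin.ext h1
    obtain rfl : τ = t.succ := Fin.ext h2
    exact (Quot.sound (.strand t j' j h4)).symm
  · obtain rfl : τ = t.castSucc := Fin.ext h1
    obtain rfl : τ' = t.castSucc := Fin.ext h2
    rcases h4 with h4 | h4
    · exact Quot.sound (.lower t j j' h4)
    · exact (Quot.sound (.lower t j' j h4)).symm
  · obtain rfl : τ = t.succ := Fin.ext h1
    obtain rfl : τ' = t.succ := Fin.ext h2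
    rcases h4 with h4 | h4
    · exact Quot.sound (.upper t j j' h4)
    · exact (Quot.sound (.upper t j' j h4)).symm
  · obtain rfl : τ = Fin.last _ := Fin.ext h1
    obtain rfl : τ' = 0 := Fin.ext h2
    exact Quot.sound (.closure j j' h4)
  · obtain rfl : τ' = Fin.last _ := Fin.ext h1
    obtain rfl : τ = 0 := Fin.ext h2
    exact (Quot.sound (.closure j' j h4.symm)).symm

/-- The circles of a resolution are the cycles of its flow. -/
theorem mk_eq_iff_sameCycle {s : D.CubeVertex} {p q : D.Point} :
    (Quot.mk _ p : D.StateCircle s) = Quot.mk _ q ↔ (flowPerm s).SameCycle p q := by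
  constructor
  · intro h
    induction Quot.eqvGen_exact h with
    | rel p q hpq =>
      rcases hpq.flow with h' | h' <;> rw [flow_iff] at h' <;> rw [← h']
      · exact Equiv.Perm.sameCycle_apply_right.2 .rfl
      · exact Equiv.Perm.sameCycle_apply_left.2 .rfl
    | refl p => exact .rfl
    | symm p q hpq ih => exact (ih (Quot.eqvGen_sound hpq)).symm
    | trans p q r hpq hqr ih ih' =>
      exact (ih (Quot.eqvGen_sound hpq)).trans (ih' (Quot.eqvGen_sound hqr))
  · intro h
    refine h.mem_of_mapsTo (T := {x | (Quot.mk _ p : D.StateCircle s) = Quot.mk _ x}) ?_ rfl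
    intro x hx
    exact Eq.trans hx (flow_flowPerm s x).mk_eq

/-! ### The effect of a crossing change on the circles -/

/-- The vertex `s'` of the cube arises from `s` by changing the smoothing of the crossing `c` from
`0` to `1`. -/
structure IsEdge (c : D.Crossing) (s s' : D.CubeVertex) : Prop where
  source : s c = false
  target : s' c = true
  eq_of_ne : ∀ b, b ≠ c → s' b = s b

theorem isEdge_update [DecidableEq D.Crossing] {c : D.Crossing} {s : D.CubeVertex}
    (h : s c = false) : IsEdge c s (Function.update s c true) :=
  ⟨h, by simp, fun _ hb => by simp [hb]⟩

namespace IsEdge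

variable {c : D.Crossing} {s s' : D.CubeVertex}

theorem smoothing_eq (h : IsEdge c s s') {t : Fin D.len} (ht : t ≠ c.1) :
    D.smoothing s' t = D.smoothing s t :=
  smoothing_congr fun _ => h.eq_of_ne _ fun h => ht (congrArg Subtype.val h)

/-- One of the two smoothings at an edge of the cube goes straight through the crossing, and the
other one turns back. -/
theorem smoothing_crossing (h : IsEdge c s s') :
    (D.smoothing s c.1 = .through ∧ D.smoothing s' c.1 = .turnback) ∨
    (D.smoothing s c.1 = .turnback ∧ D.smoothing s' c.1 = .through) := by
  rcases AnnularDiagram.smoothing_crossing s c with ⟨hk, h1⟩ | ⟨hk, h1⟩ <;>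
  rcases AnnularDiagram.smoothing_crossing s' c with ⟨hk', h1'⟩ | ⟨hk', h1'⟩ <;>
  simp_all [h.source, h.target]

end IsEdge

/-- If two resolutions differ in how they smooth the crossing `c`, then their flows differ by the
transposition of the two points `x` and `y` at which the flow enters the crossing; the circles
through these points are the circles through the two corners. -/
theorem exists_flowPerm_eq_mul_swap [DecidableEq D.Point] {c : D.Crossing} {s s' : D.CubeVertex}
    (hne : ∀ t ≠ c.1, D.smoothing s' t = D.smoothing s t)
    (h : D.smoothing s c.1 = .through) (h' : D.smoothing s' c.1 = .turnback) :
    ∃ x y : D.Point, x ≠ y ∧ flowPerm s' = flowPerm s * Equiv.swap x y ∧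
      ∀ r, r = s ∨ r = s' →
        ((flowPerm r).SameCycle c.corner x ∧ (flowPerm r).SameCycle c.oppositeCorner y) ∨
        ((flowPerm r).SameCycle c.corner y ∧ (flowPerm r).SameCycle c.oppositeCorner x) := by
  have hw := (D.kind c.1).fits_crossing c.2 (D.fits c.1)
  set i := D.pos c.1 with hi
  -- the lower end points `x`, `x'` and the upper end points `y`, `y'` of the crossing; the flow
  -- enters it at `x` and `y` and leaves it at `x'` and `y'`
  let x : D.Point := ⟨c.1.castSucc, i + i % 2, by omega⟩
  let x' : D.Point := ⟨c.1.castSucc, i + 1 - i % 2, by omega⟩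
  let y : D.Point := ⟨c.1.succ, i + 1 - i % 2, by omega⟩
  let y' : D.Point := ⟨c.1.succ, i + i % 2, by omega⟩
  have hpar : (i + i % 2) % 2 = 0 ∧ (i + 1 - i % 2) % 2 = 1 := by omega
  have h1 : Flow s x y' := Or.inl ⟨c.1, by simp [x], by simp [y'],
    by simp only [y', Nat.even_iff]; omega, by rw [h]; rfl⟩
  have h2 : Flow s y x' := Or.inr <| Or.inl ⟨c.1, by simp [x'], by simp [y],
    by simp only [x', Nat.odd_iff]; omega, by rw [h]; rfl⟩
  have h3 : Flow s' x x' := Or.inr <| Or.inr <| Or.inl ⟨c.1, by simp [x], by simp [x'],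
    by simp only [x', Nat.odd_iff]; omega, by
      rw [h']; simp only [FlatKind.LowerArc, x, x']; omega⟩
  have h4 : Flow s' y y' := Or.inr <| Or.inr <| Or.inr <| Or.inl ⟨c.1, by simp [y], by simp [y'],
    by simp only [y', Nat.even_iff]; omega, by
      rw [h']; simp only [FlatKind.UpperArc, y, y']; omega⟩
  have hrest : ∀ p q, p ≠ x → p ≠ y → Flow s p q → Flow s' p q := by
    intro p q hpx hpy hf
    rcases hf with ⟨t, g1, g2, g3, g4⟩ | ⟨t, g1, g2, g3, g4⟩ | ⟨t, g1, g2, g3, g4⟩ |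
      ⟨t, g1, g2, g3, g4⟩ | ⟨g1, g2, g3, g4⟩ | ⟨g1, g2, g3, g4⟩
    · refine Or.inl ⟨t, g1, g2, g3, ?_⟩
      rcases eq_or_ne t c.1 with rfl | ht
      · rw [h] at g4
        rw [h']
        have hp : (p.2 : ℕ) ≠ i + i % 2 := fun hp => hpx (Point.ext_val g1 hp)
        simp only [FlatKind.Strand, Nat.even_iff] at g3 g4 ⊢
        omega
      · rwa [hne t ht]
    · refine Or.inr <| Or.inl ⟨t, g1, g2, g3, ?_⟩
      rcases eq_or_ne t c.1 with rfl | ht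
      · rw [h] at g4
        rw [h']
        have hp : (p.2 : ℕ) ≠ i + 1 - i % 2 := fun hp => hpy (Point.ext_val g2 hp)
        simp only [FlatKind.Strand, Nat.odd_iff] at g3 g4 ⊢
        omega
      · rwa [hne t ht]
    · refine Or.inr <| Or.inr <| Or.inl ⟨t, g1, g2, g3, ?_⟩
      rcases eq_or_ne t c.1 with rfl | ht
      · rw [h] at g4
        exact (g4.elim id id).elim
      · rwa [hne t ht]
    · refine Or.inr <| Or.inr <| Or.inr <| Or.inl ⟨t, g1, g2, g3, ?_⟩
      rcases eq_or_ne t c.1 with rfl | ht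
      · rw [h] at g4
        exact (g4.elim id id).elim
      · rwa [hne t ht]
    · exact Or.inr <| Or.inr <| Or.inr <| Or.inr <| Or.inl ⟨g1, g2, g3, g4⟩
    · exact Or.inr <| Or.inr <| Or.inr <| Or.inr <| Or.inr ⟨g1, g2, g3, g4⟩
  refine ⟨x, y, ?_, ?_, ?_⟩
  · intro hxy
    have := congrArg (fun p : D.Point => (p.1 : ℕ)) hxy
    simp [x, y] at this
  · ext1 p
    rw [Equiv.Perm.mul_apply]
    rcases eq_or_ne p x with rfl | hpx
    · rw [Equiv.swap_apply_left, flow_iff.1 h2, flow_iff.1 h3]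
    · rcases eq_or_ne p y with rfl | hpy
      · rw [Equiv.swap_apply_right, flow_iff.1 h1, flow_iff.1 h4]
      · rw [Equiv.swap_apply_of_ne_of_ne hpx hpy]
        exact flow_iff.1 (hrest p _ hpx hpy (flow_flowPerm s p))
  · have hc : (c.corner = x ∧ c.oppositeCorner = y) ∨ (c.corner = x' ∧ c.oppositeCorner = y') := by
      rcases Nat.mod_two_eq_zero_or_one i with h0 | h0
      · left
        constructor <;> refine Point.ext_val rfl ?_ <;>
          simp only [Crossing.corner, Crossing.oppositeCorner, x, y] <;> omega
      · right
        constructor <;> refine Point.ext_val rfl ?_ <;>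
          simp only [Crossing.corner, Crossing.oppositeCorner, x', y'] <;> omega
    rintro r (rfl | rfl)
    · rcases hc with ⟨hc1, hc2⟩ | ⟨hc1, hc2⟩ <;> rw [hc1, hc2]
      · exact Or.inl ⟨.rfl, .rfl⟩
      · refine Or.inr ⟨?_, ?_⟩ <;> simp only [← mk_eq_iff_sameCycle]
        exacts [h2.mk_eq.symm, h1.mk_eq.symm]
    · rcases hc with ⟨hc1, hc2⟩ | ⟨hc1, hc2⟩ <;> rw [hc1, hc2]
      · exact Or.inl ⟨.rfl, .rfl⟩
      · refine Or.inl ⟨?_, ?_⟩ <;> simp only [← mk_eq_iff_sameCycle]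
        exacts [h3.mk_eq.symm, h4.mk_eq.symm]

namespace IsEdge

variable {c : D.Crossing} {s s' : D.CubeVertex}

theorem exists_flowPerm_eq_mul_swap [DecidableEq D.Point] (h : IsEdge c s s') :
    ∃ x y : D.Point, x ≠ y ∧ flowPerm s' = flowPerm s * Equiv.swap x y ∧
      ∀ r, r = s ∨ r = s' →
        ((flowPerm r).SameCycle c.corner x ∧ (flowPerm r).SameCycle c.oppositeCorner y) ∨
        ((flowPerm r).SameCycle c.corner y ∧ (flowPerm r).SameCycle c.oppositeCorner x) := by
  rcases h.smoothing_crossing with ⟨h1, h2⟩ | ⟨h1, h2⟩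
  · exact AnnularDiagram.exists_flowPerm_eq_mul_swap (fun t ht => h.smoothing_eq ht) h1 h2
  · obtain ⟨x, y, hxy, hσ, hr⟩ := AnnularDiagram.exists_flowPerm_eq_mul_swap
      (fun t ht => (h.smoothing_eq ht).symm) h2 h1
    refine ⟨x, y, hxy, ?_, fun r hr' => hr r hr'.symm⟩
    rw [hσ, mul_assoc, Equiv.swap_mul_self, mul_one]

/-- Changing the smoothing of a crossing either merges two circles or splits a circle in two; it
never turns one circle into one circle. -/
theorem mk_corner_eq_iff (h : IsEdge c s s') :
    (Quot.mk _ c.corner : D.StateCircle s) = Quot.mk _ c.oppositeCorner ↔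
      (Quot.mk _ c.corner : D.StateCircle s') ≠ Quot.mk _ c.oppositeCorner := by
  classical
  obtain ⟨x, y, hxy, hσ, hr⟩ := h.exists_flowPerm_eq_mul_swap
  have key : ∀ r, r = s ∨ r = s' → ((flowPerm r).SameCycle c.corner c.oppositeCorner ↔
      (flowPerm r).SameCycle x y) := by
    intro r hr'
    rcases hr r hr' with ⟨h1, h2⟩ | ⟨h1, h2⟩
    · exact ⟨fun h => h1.symm.trans (h.trans h2), fun h => h1.trans (h.trans h2.symm)⟩
    · exact ⟨fun h => (h1.symm.trans (h.trans h2)).symm,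
        fun h => h1.trans (h.symm.trans h2.symm)⟩
  rw [ne_eq, mk_eq_iff_sameCycle, mk_eq_iff_sameCycle, key s (.inl rfl), key s' (.inr rfl), hσ]
  refine ⟨Equiv.Perm.not_sameCycle_mul_swap hxy, fun h => ?_⟩
  by_contra h'
  exact h (Equiv.Perm.sameCycle_mul_swap_of_not h')

/-- Changing the smoothing of a crossing does not affect the circles that do not run through it. -/
theorem mk_eq_iff (h : IsEdge c s s') {p : D.Point} (q : D.Point)
    (h1 : (Quot.mk _ p : D.StateCircle s) ≠ Quot.mk _ c.corner)
    (h2 : (Quot.mk _ p : D.StateCircle s) ≠ Quot.mk _ c.oppositeCorner) :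
    (Quot.mk _ p : D.StateCircle s) = Quot.mk _ q ↔
      (Quot.mk _ p : D.StateCircle s') = Quot.mk _ q := by
  classical
  obtain ⟨x, y, hxy, hσ, hr⟩ := h.exists_flowPerm_eq_mul_swap
  rw [ne_eq, mk_eq_iff_sameCycle] at h1 h2
  rw [mk_eq_iff_sameCycle, mk_eq_iff_sameCycle, hσ]
  have : ¬ (flowPerm s).SameCycle p x ∧ ¬ (flowPerm s).SameCycle p y := by
    rcases hr s (.inl rfl) with ⟨h3, h4⟩ | ⟨h3, h4⟩
    · exact ⟨fun h => h1 (h.trans h3.symm), fun h => h2 (h.trans h4.symm)⟩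
    · exact ⟨fun h => h2 (h.trans h4.symm), fun h => h1 (h.trans h3.symm)⟩
  exact ⟨Equiv.Perm.sameCycle_mul_swap_of_not_sameCycle this.1 this.2,
    Equiv.Perm.sameCycle_of_sameCycle_mul_swap this.1 this.2⟩

theorem mk_eq_iff' (h : IsEdge c s s') {p : D.Point} (q : D.Point)
    (h1 : (Quot.mk _ p : D.StateCircle s') ≠ Quot.mk _ c.corner)
    (h2 : (Quot.mk _ p : D.StateCircle s') ≠ Quot.mk _ c.oppositeCorner) :
    (Quot.mk _ p : D.StateCircle s) = Quot.mk _ q ↔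
      (Quot.mk _ p : D.StateCircle s') = Quot.mk _ q := by
  classical
  obtain ⟨x, y, hxy, hσ, hr⟩ := h.exists_flowPerm_eq_mul_swap
  rw [ne_eq, mk_eq_iff_sameCycle] at h1 h2
  have hσ' : flowPerm s = flowPerm s' * Equiv.swap x y := by
    rw [hσ, mul_assoc, Equiv.swap_mul_self, mul_one]
  rw [mk_eq_iff_sameCycle, mk_eq_iff_sameCycle, hσ']
  have : ¬ (flowPerm s').SameCycle p x ∧ ¬ (flowPerm s').SameCycle p y := by
    rcases hr s' (.inr rfl) with ⟨h3, h4⟩ | ⟨h3, h4⟩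
    · exact ⟨fun h => h1 (h.trans h3.symm), fun h => h2 (h.trans h4.symm)⟩
    · exact ⟨fun h => h2 (h.trans h4.symm), fun h => h1 (h.trans h3.symm)⟩
  exact ⟨Equiv.Perm.sameCycle_of_sameCycle_mul_swap this.1 this.2,
    Equiv.Perm.sameCycle_mul_swap_of_not_sameCycle this.1 this.2⟩

end IsEdge

end AnnularDiagram

/-! ### Winding numbers -/

namespace AnnularDiagram

open Finset

/-- Inserting two equal values at the positions `i` and `i + 1` does not change the parity of the
partial sums. -/
theorem sum_range_add_two {f g : ℕ → ℕ} {i : ℕ} (h1 : ∀ x < i, g x = f x)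
    (h2 : ∀ x, i ≤ x → g (x + 2) = f x) (h3 : g i = g (i + 1)) {n : ℕ} (hn : i ≤ n) :
    (∑ x ∈ range (n + 2), g x) % 2 = (∑ x ∈ range n, f x) % 2 := by
  induction n, hn using Nat.le_induction with
  | base =>
    have : ∑ x ∈ range i, g x = ∑ x ∈ range i, f x :=
      sum_congr rfl fun x hx => h1 x (mem_range.1 hx)
    rw [sum_range_succ, sum_range_succ, this]
    omega
  | succ n hn ih =>
    rw [sum_range_succ, sum_range_succ _ n, h2 n hn]
    omega

theorem sum_range_of_pairs {f g : ℕ → ℕ} {i : ℕ} (h1 : ∀ x, x ≠ i → x ≠ i + 1 → g x = f x)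
    (h2 : f i = f (i + 1)) (h3 : g i = g (i + 1)) {n : ℕ} (hn : n ≠ i + 1) :
    (∑ x ∈ range n, g x) % 2 = (∑ x ∈ range n, f x) % 2 := by
  have h0 : ∑ x ∈ range i, g x = ∑ x ∈ range i, f x :=
    sum_congr rfl fun x hx => by rw [mem_range] at hx; exact h1 x (by omega) (by omega)
  rcases Nat.lt_or_ge n (i + 1) with h | h
  · rw [sum_congr rfl fun x hx => h1 x _ _] <;> grind
  · have hn' : i + 2 ≤ n := by omega
    clear hn h
    induction n, hn' using Nat.le_induction with
    | base =>
      rw [sum_range_succ, sum_range_succ, sum_range_succ _ (i + 1), sum_range_succ _ i, h0]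
      omega
    | succ n hn ih =>
      rw [sum_range_succ, sum_range_succ _ n, h1 n (by omega) (by omega)]
      omega

/-- The signs `(-1) ^ rank` of the elements of a finite set of naturals alternate, so that they add
up to `0` or `1`, according to the parity of the number of elements. -/
theorem sum_neg_one_pow_rank (c : ℕ → Prop) [DecidablePred c] (n : ℕ) :
    (∑ j ∈ range n, if c j then (-1 : ℤ) ^ (∑ x ∈ range j, if c x then 1 else 0) else 0) =
      if Odd (∑ x ∈ range n, if c x then 1 else 0) then 1 else 0 := by
  induction n with
  | zero => simp
  | succ n ih =>
    rw [sum_range_succ, sum_range_succ _ n, ih]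
    by_cases hc : c n
    · simp only [hc, if_true]
      rcases Nat.even_or_odd (∑ x ∈ range n, if c x then 1 else 0) with h | h
      · rw [h.neg_one_pow, if_neg (Nat.not_odd_iff_even.2 h), if_pos h.add_one, zero_add]
      · rw [h.neg_one_pow, if_pos h, if_neg (Nat.not_odd_iff_even.2 h.add_one)]
        norm_num
    · simp [hc]

variable {D : AnnularDiagram}

open Classical in
/-- The indicator function of a property `B` of the points of a level. -/
noncomputable def indicatorAt (B : D.Point → Prop) (τ : Fin (D.len + 1)) (x : ℕ) : ℕ :=
  if ∃ h, B ⟨τ, x, h⟩ then 1 else 0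

/-- The number of points with the property `B` among the innermost `n` points of a level. -/
noncomputable def countBelow (B : D.Point → Prop) (τ : Fin (D.len + 1)) (n : ℕ) : ℕ :=
  ∑ x ∈ range n, indicatorAt B τ x

theorem indicatorAt_of_not {B : D.Point → Prop} {p : D.Point} (h : ¬ B p) :
    indicatorAt B p.1 p.2 = 0 :=
  if_neg fun ⟨_, h'⟩ => h h'

/-- Along a circle without the property `B`, the parity of the number of points below it that have
the property `B` is constant: the two end points of an arc that turns back are either both counted
or both not counted. -/
theorem Joined.countBelow_mod_two {s : D.CubeVertex} {B : D.Point → Prop}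
    (hB : ∀ p q, D.Joined s p q → (B p ↔ B q)) {p q : D.Point} (h : D.Joined s p q) (hp : ¬ B p) :
    countBelow B p.1 p.2 % 2 = countBelow B q.1 q.2 % 2 := by
  classical
  unfold countBelow
  cases h with
  | lower t j j' h =>
    have h1 : (j' : ℕ) = j + 1 := by
      cases hk : D.smoothing s t <;> rw [hk] at h <;> simp only [FlatKind.LowerArc] at h <;> omega
    dsimp only
    rw [h1, sum_range_succ, show indicatorAt B _ j = 0 from indicatorAt_of_not hp, add_zero]
  | upper t j j' h =>
    have h1 : (j' : ℕ) = j + 1 := by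
      cases hk : D.smoothing s t <;> rw [hk] at h <;> simp only [FlatKind.UpperArc] at h <;> omega
    dsimp only
    rw [h1, sum_range_succ, show indicatorAt B _ j = 0 from indicatorAt_of_not hp, add_zero]
  | closure j j' h =>
    dsimp only
    rw [h]
    refine congrArg (· % 2) (sum_congr rfl fun x hx => ?_)
    refine if_congr ⟨?_, ?_⟩ rfl rfl
    · rintro ⟨hx, hb⟩
      exact ⟨D.closed ▸ hx, (hB _ _ (.closure ⟨x, hx⟩ ⟨x, D.closed ▸ hx⟩ rfl)).1 hb⟩
    · rintro ⟨hx, hb⟩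
      exact ⟨D.closed ▸ hx, (hB _ _ (.closure ⟨x, D.closed ▸ hx⟩ ⟨x, hx⟩ rfl)).2 hb⟩
  | strand t j j' h =>
    dsimp only
    have hf := smoothing_fits s t
    have hs : ∀ x x', (D.smoothing s t).Strand (D.pos t) x x' →
        (x < D.width t.castSucc ↔ x' < D.width t.succ) →
        indicatorAt B t.succ x' =
          indicatorAt B t.castSucc x := by
      intro x x' hx hlt
      refine if_congr ⟨?_, ?_⟩ rfl rfl
      · rintro ⟨h', hb⟩
        exact ⟨hlt.2 h', (hB _ _ (.strand t ⟨x, hlt.2 h'⟩ ⟨x', h'⟩ hx)).2 hb⟩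
      · rintro ⟨h', hb⟩
        exact ⟨hlt.1 h', (hB _ _ (.strand t ⟨x, h'⟩ ⟨x', hlt.1 h'⟩ hx)).1 hb⟩
    have hl : ∀ x x', (D.smoothing s t).LowerArc (D.pos t) x x' → x < D.width t.castSucc →
        x' < D.width t.castSucc →
        indicatorAt B t.castSucc x =
          indicatorAt B t.castSucc x' := by
      intro x x' hx h1 h2
      have := hB _ _ (.lower t ⟨x, h1⟩ ⟨x', h2⟩ hx)
      exact if_congr ⟨fun ⟨_, hb⟩ => ⟨h2, this.1 hb⟩, fun ⟨_, hb⟩ => ⟨h1, this.2 hb⟩⟩ rfl rfl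
    have hu : ∀ x x', (D.smoothing s t).UpperArc (D.pos t) x x' → x < D.width t.succ →
        x' < D.width t.succ →
        indicatorAt B t.succ x =
          indicatorAt B t.succ x' := by
      intro x x' hx h1 h2
      have := hB _ _ (.upper t ⟨x, h1⟩ ⟨x', h2⟩ hx)
      exact if_congr ⟨fun ⟨_, hb⟩ => ⟨h2, this.1 hb⟩, fun ⟨_, hb⟩ => ⟨h1, this.2 hb⟩⟩ rfl rfl
    obtain ⟨j, hj⟩ := j
    obtain ⟨j', hj'⟩ := j'
    clear hp
    dsimp only at h ⊢
    cases hk : D.smoothing s t <;> rw [hk] at hf hs hl hu h <;>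
      simp only [FlatKind.Fits, FlatKind.Strand, FlatKind.LowerArc, FlatKind.UpperArc]
        at hf hs hl hu h
    · rcases h with ⟨h, rfl⟩ | ⟨h, rfl⟩
      · exact congrArg (· % 2) (sum_congr rfl fun x hx => by
          rw [mem_range] at hx; exact (hs x x (by omega) (by omega)).symm)
      · exact (sum_range_add_two (fun x hx => hs x x (by omega) (by omega))
          (fun x hx => hs x (x + 2) (by omega) (by omega))
          (hu _ _ ⟨rfl, rfl⟩ (by omega) (by omega)) h).symm
    · rcases h with ⟨h, rfl⟩ | ⟨h, rfl⟩
      · exact congrArg (· % 2) (sum_congr rfl fun x hx => by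
          rw [mem_range] at hx; exact (hs x x (by omega) (by omega)).symm)
      · exact sum_range_add_two (fun x hx => (hs x x (by omega) (by omega)).symm)
          (fun x hx => (hs (x + 2) x (by omega) (by omega)).symm)
          (hl _ _ ⟨rfl, rfl⟩ (by omega) (by omega)) h
    · subst h
      exact congrArg (· % 2) (sum_congr rfl fun x hx => (hs x x rfl (by omega)).symm)
    · obtain ⟨h1, h2, rfl⟩ := h
      exact (sum_range_of_pairs (fun x h3 h4 => hs x x ⟨h3, h4, rfl⟩ (by omega))
        (hl _ _ ⟨rfl, rfl⟩ (by omega) (by omega)) (hu _ _ ⟨rfl, rfl⟩ (by omega) (by omega)) h2).symm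

open Classical in
/-- The winding number of a circle of a resolution around the annulus, with respect to the
checkerboard orientation: the strands at even positions run upwards, and those at odd positions
downwards. -/
noncomputable def winding (s : D.CubeVertex) (C : D.StateCircle s) : ℤ :=
  ∑ j : Fin (D.width 0), if (Quot.mk _ ⟨0, j⟩ : D.StateCircle s) = C then (-1) ^ (j : ℕ) else 0

/-- A circle winds at most once around the annulus. Its intersection points with the level `0` have
alternating signs: the sign of such a point is determined by its rank among these points and by the
parity of the number of points below it that belong to other circles, which is constant along the
circle. -/
theorem winding_eq (s : D.CubeVertex) (C : D.StateCircle s) :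
    ∃ ν : ℤ, (ν = 1 ∨ ν = -1) ∧ (D.Nontrivial s C → winding s C = ν) ∧
      (¬ D.Nontrivial s C → winding s C = 0) := by
  classical
  obtain ⟨p₀, rfl⟩ := Quot.exists_rep C
  set C : D.StateCircle s := Quot.mk _ p₀ with hC
  let A : D.Point → Prop := fun p => (Quot.mk _ p : D.StateCircle s) = C
  let B : D.Point → Prop := fun p => (Quot.mk _ p : D.StateCircle s) ≠ C
  have hconst : ∀ p q : D.Point, (Quot.mk _ p : D.StateCircle s) = Quot.mk _ q → A p →
      countBelow B p.1 p.2 % 2 = countBelow B q.1 q.2 % 2 := by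
    intro p q h
    induction Quot.eqvGen_exact h with
    | rel p q hpq =>
      intro hp
      refine hpq.countBelow_mod_two (fun p' q' h' => ?_) (not_not.2 hp)
      simp only [B, show (Quot.mk _ p' : D.StateCircle s) = Quot.mk _ q' from Quot.sound h']
    | refl p => exact fun _ => rfl
    | symm p q hpq ih =>
      intro hq
      exact (ih (Quot.eqvGen_sound hpq) (Eq.trans (Quot.eqvGen_sound hpq) hq)).symm
    | trans p q r hpq hqr ih ih' =>
      intro hp
      exact (ih (Quot.eqvGen_sound hpq) hp).trans
        (ih' (Quot.eqvGen_sound hqr) (Eq.trans (Quot.eqvGen_sound hpq).symm hp))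
  have hcard : Nat.card {j : Fin (D.width 0) // (Quot.mk _ ⟨0, j⟩ : D.StateCircle s) = C} =
      ∑ x ∈ range (D.width 0), if ∃ h, A ⟨0, x, h⟩ then 1 else 0 := by
    rw [Nat.card_eq_fintype_card, Fintype.card_subtype, card_filter, ← Fin.sum_univ_eq_sum_range
      (fun x => if ∃ h, A ⟨0, x, h⟩ then 1 else 0)]
    exact sum_congr rfl fun j _ => if_congr ⟨fun h => ⟨j.2, h⟩, fun ⟨_, h⟩ => h⟩ rfl rfl
  set ν : ℤ := (-1) ^ countBelow B p₀.1 p₀.2 with hν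
  have hw : winding s C = ν * if D.Nontrivial s C then 1 else 0 := by
    unfold Nontrivial
    simp only [hcard]
    rw [← sum_neg_one_pow_rank (fun x => ∃ h, A ⟨0, x, h⟩), mul_sum, winding]
    rw [← Fin.sum_univ_eq_sum_range (fun x => ν * if ∃ h, A ⟨0, x, h⟩ then
      (-1) ^ (∑ y ∈ range x, if ∃ h, A ⟨0, y, h⟩ then 1 else 0) else 0)]
    refine sum_congr rfl fun j _ => ?_
    by_cases hj : (Quot.mk _ ⟨0, j⟩ : D.StateCircle s) = C
    · have hj' : ∃ h, A ⟨0, (j : ℕ), h⟩ := ⟨j.2, hj⟩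
      rw [if_pos hj, if_pos hj', hν, ← pow_add]
      have h1 := hconst ⟨0, j⟩ p₀ (hj.trans hC) hj
      have h2 : (j : ℕ) = countBelow B 0 j + ∑ y ∈ range j, if ∃ h, A ⟨0, y, h⟩ then 1 else 0 := by
        rw [countBelow, ← sum_add_distrib]
        conv_lhs => rw [← card_range j, card_eq_sum_ones]
        refine sum_congr rfl fun y hy => ?_
        have hy' : y < D.width 0 := (mem_range.1 hy).trans j.2
        by_cases h : A ⟨0, y, hy'⟩
        · simp [indicatorAt, B, hy', h, show (Quot.mk _ ⟨0, y, hy'⟩ : D.StateCircle s) = C from h]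
        · simp [indicatorAt, B, hy', h, show (Quot.mk _ ⟨0, y, hy'⟩ : D.StateCircle s) ≠ C from h]
      conv_lhs => rw [h2]
      rw [neg_one_pow_eq_pow_mod_two, neg_one_pow_eq_pow_mod_two (n := countBelow B p₀.1 _ + _),
        Nat.add_mod, h1, ← Nat.add_mod]
    · have hj' : ¬ ∃ h, A ⟨0, (j : ℕ), h⟩ := fun ⟨_, h⟩ => hj h
      rw [if_neg hj, if_neg hj', mul_zero]
  refine ⟨ν, neg_one_pow_eq_or ℤ _, fun h => ?_, fun h => ?_⟩
  · rw [hw, if_pos h, mul_one]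
  · rw [hw, if_neg h, mul_zero]

theorem winding_eq_neg_one_or_zero_or_one (s : D.CubeVertex) (C : D.StateCircle s) :
    winding s C = -1 ∨ winding s C = 0 ∨ winding s C = 1 := by
  obtain ⟨ν, hν, h1, h2⟩ := winding_eq s C
  by_cases h : D.Nontrivial s C
  · rw [h1 h]; tauto
  · rw [h2 h]; tauto

theorem nontrivial_iff_winding_ne_zero {s : D.CubeVertex} {C : D.StateCircle s} :
    D.Nontrivial s C ↔ winding s C ≠ 0 := by
  obtain ⟨ν, hν, h1, h2⟩ := winding_eq s C
  refine ⟨fun h => ?_, fun h => by_contra fun h' => h (h2 h')⟩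
  rw [h1 h]
  rcases hν with rfl | rfl <;> decide

end AnnularDiagram

section

open Finset Function

/-! ### Ladder operators on signed circles -/

namespace Signs

variable {X : Type*}

/-- Reverse the signs of the circles with nonzero winding number. -/
def reverse (w : X → ℤ) (f : X → Bool) (x : X) : Bool :=
  if w x = 0 then f x else !f x

theorem reverse_reverse (w : X → ℤ) (f : X → Bool) : reverse w (reverse w f) = f := by
  ext x
  unfold reverse
  split <;> simp

variable [Fintype X]

/-- The total sign of the circles, weighted by the squares of their winding numbers. -/
def weight (w : X → ℤ) (f : X → Bool) : ℤ :=
  ∑ x, w x ^ 2 * if f x then 1 else -1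

theorem weight_reverse (w : X → ℤ) (f : X → Bool) : weight w (reverse w f) = -weight w f := by
  unfold weight reverse
  rw [← sum_neg_distrib]
  refine sum_congr rfl fun x _ => ?_
  by_cases h : w x = 0
  · simp [h]
  · cases h' : f x <;> simp [h]

variable [DecidableEq X]

theorem weight_update_true (w : X → ℤ) {f : X → Bool} {x : X} (h : f x = false) :
    weight w (update f x true) = weight w f + 2 * w x ^ 2 := by
  unfold weight
  rw [← add_sum_erase _ _ (mem_univ x), ← add_sum_erase _ (fun y => w y ^ 2 * _) (mem_univ x),
    sum_congr rfl fun y hy => by rw [update_of_ne (ne_of_mem_erase hy)]]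
  simp only [update_self, h]
  simp
  ring

theorem weight_update_false (w : X → ℤ) {f : X → Bool} {x : X} (h : f x = true) :
    weight w (update f x false) = weight w f - 2 * w x ^ 2 := by
  have := weight_update_true w (f := update f x false) (x := x) (update_self ..)
  rw [update_idem, ← h, update_eq_self] at this
  omega

/-- The ladder operators on the vector space with the sign assignments `f : X → Bool` as basis;
vectors are written as coefficient functions. The raising operator `ladder w true` sends a basis
vector to the sum over the circles `C` of sign `-` of `w C` times the basis vector in which the sign
of `C` is replaced by `+`, and the lowering operator `ladder w false` does the opposite. -/
noncomputable def ladder (w : X → ℤ) (b : Bool) (x : (X → Bool) → ℂ) (f : X → Bool) : ℂ :=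
  ∑ C, if f C = b then (w C : ℂ) * x (update f C !b) else 0

theorem ladder_commutator (w : X → ℤ) (x : (X → Bool) → ℂ) (f : X → Bool) :
    ladder w true (ladder w false x) f - ladder w false (ladder w true x) f =
      weight w f * x f := by
  have expand : ∀ b, ladder w b (ladder w (!b) x) f = ∑ C, ∑ C',
      if f C = b ∧ update f C (!b) C' = !b then
        (w C : ℂ) * w C' * x (update (update f C !b) C' b) else 0 := by
    intro b
    refine sum_congr rfl fun C _ => ?_
    by_cases h : f C = b
    · simp [h, ladder, mul_sum, mul_assoc]
    · simp [h]
  have h1 := expand true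
  have h2 := expand false
  rw [sum_comm] at h2
  rw [Bool.not_true] at h1
  rw [Bool.not_false] at h2
  rw [h1, h2, ← sum_sub_distrib, weight, Int.cast_sum, sum_mul]
  refine sum_congr rfl fun C _ => ?_
  -- the terms in which the signs of two different circles are changed cancel
  rw [← sum_sub_distrib, sum_eq_single C]
  · have h3 : ∀ b, f C = b → update f C b = f := fun b h => by rw [← h, update_eq_self]
    cases h : f C <;> simp [h3 _ h, pow_two]
  · intro C' _ hne
    simp only [update_of_ne hne, update_of_ne hne.symm]
    rw [update_comm hne, sub_eq_zero]
    refine if_congr (and_comm) ?_ rfl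
    ring
  · simp

/-- The lowering and raising operators are transposes of each other. -/
theorem sum_mul_ladder (w : X → ℤ) (a x : (X → Bool) → ℂ) :
    ∑ f, a f * ladder w false x f = ∑ f, ladder w true a f * x f := by
  unfold ladder
  simp only [mul_sum, sum_mul]
  rw [sum_comm, sum_comm (s := univ) (t := univ) (f := fun f C => _ * x f)]
  refine sum_congr rfl fun C _ => ?_
  have hflip : Involutive fun f : X → Bool => update f C !f C := fun f => by simp
  rw [← Equiv.sum_comp hflip.toPerm]
  refine sum_congr rfl fun f _ => ?_
  cases h : f C
  · simp [h]
  · have : update f C true = f := by rw [← h, update_eq_self]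
    simp [h, this]
    ring

theorem ladder_true_eq (w : X → ℤ) (x : (X → Bool) → ℂ) (f : X → Bool) :
    ladder w true x f = ladder w false (fun g => x (reverse w g)) (reverse w f) := by
  refine sum_congr rfl fun C _ => ?_
  rcases eq_or_ne (w C) 0 with h | h
  · simp [h]
  · have h1 : reverse w (update (reverse w f) C true) = update f C false := by
      ext y
      rcases eq_or_ne y C with rfl | hy
      · simp [reverse, h]
      · have := congrFun (reverse_reverse w f) y
        simpa [reverse, hy] using this
    have h2 : reverse w f C = false ↔ f C = true := by simp [reverse, h]
    simp [h1, h2]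

end Signs

/-! ### Merges and splits -/

open Signs

/-- The map `π` between sets of circles identifies the two circles `P` and `Q` and is otherwise
bijective: this describes the effect of merging two circles and, read backwards, that of splitting
a circle. -/
structure IsMerge {X Y : Type*} (π : X → Y) (P Q : X) : Prop where
  ne : P ≠ Q
  map_eq : π P = π Q
  surjective : Surjective π
  eq_or_of_map_eq : ∀ x y, π x = π y → x = y ∨ (x = P ∧ y = Q) ∨ (x = Q ∧ y = P)

namespace IsMerge

variable {X Y : Type*} {π : X → Y} {P Q : X}

/-- The signs `f` and `g` agree on the circles that do not take part in the merge or split. -/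
def Agree (π : X → Y) (P Q : X) (f : X → Bool) (g : Y → Bool) : Prop :=
  ∀ x, x ≠ P → x ≠ Q → g (π x) = f x

open Classical in
/-- The matrix entries of the merge map, from the signs `f` to the signs `g`. -/
noncomputable def mergeEntry (π : X → Y) (P Q : X) (f : X → Bool) (g : Y → Bool) : ℂ :=
  if Agree π P Q f g then mergeCoeff (f P) (f Q) (g (π P)) else 0

open Classical in
/-- The matrix entries of the split map, from the signs `g` to the signs `f`. -/
noncomputable def splitEntry (π : X → Y) (P Q : X) (g : Y → Bool) (f : X → Bool) : ℂ :=
  if Agree π P Q f g then splitCoeff (g (π P)) (f P) (f Q) else 0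

theorem map_ne (h : IsMerge π P Q) {x : X} (hP : x ≠ P) (hQ : x ≠ Q) : π x ≠ π P := by
  intro h'
  rcases h.eq_or_of_map_eq _ _ h' with h' | ⟨h', _⟩ | ⟨h', _⟩ <;> contradiction

theorem eq_of_map_eq (h : IsMerge π P Q) {x y : X} (hP : x ≠ P) (hQ : x ≠ Q) (hxy : π x = π y) :
    x = y := by
  rcases h.eq_or_of_map_eq _ _ hxy with h' | ⟨h', _⟩ | ⟨h', _⟩
  · exact h'
  · contradiction
  · contradiction

section Sums

variable {M : Type*} [AddCommMonoid M] [Fintype X] [DecidableEq X]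

theorem sum_source (h : IsMerge π P Q) (φ : X → M) :
    ∑ x, φ x = φ P + φ Q + ∑ x ∈ univ.filter (fun x => x ≠ P ∧ x ≠ Q), φ x := by
  rw [← sum_filter_add_sum_filter_not univ (fun x => x ≠ P ∧ x ≠ Q), add_comm]
  congr 1
  rw [← sum_pair h.ne]
  refine sum_congr ?_ fun _ _ => rfl
  ext x
  simp only [mem_filter, mem_univ, true_and, mem_insert, mem_singleton]
  tauto

theorem sum_target [Fintype Y] (h : IsMerge π P Q) (φ : Y → M) :
    ∑ y, φ y = φ (π P) + ∑ x ∈ univ.filter (fun x => x ≠ P ∧ x ≠ Q), φ (π x) := by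
  classical
  rw [← sum_image (f := φ) (g := π), ← sum_insert]
  · refine sum_congr ?_ fun _ _ => rfl
    ext y
    obtain ⟨x, rfl⟩ := h.surjective y
    simp only [mem_univ, mem_insert, mem_image, mem_filter, true_and, true_iff]
    by_cases hP : x = P
    · exact Or.inl (hP ▸ rfl)
    · by_cases hQ : x = Q
      · exact Or.inl (hQ ▸ h.map_eq.symm)
      · exact Or.inr ⟨x, ⟨hP, hQ⟩, rfl⟩
  · simp only [mem_image, mem_filter, mem_univ, true_and]
    rintro ⟨x, ⟨hP, hQ⟩, hx⟩
    exact h.map_ne hP hQ hx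
  · intro x hx y _ hxy
    have hx := (mem_filter.1 (mem_coe.1 hx)).2
    exact h.eq_of_map_eq hx.1 hx.2 hxy

end Sums

section Update

theorem agree_update_source_left [DecidableEq X] {f : X → Bool} {g : Y → Bool} {b : Bool} :
    Agree π P Q (update f P b) g ↔ Agree π P Q f g :=
  forall_congr' fun x => forall_congr' fun hP => by rw [update_of_ne hP]

theorem agree_update_source_right [DecidableEq X] {f : X → Bool} {g : Y → Bool} {b : Bool} :
    Agree π P Q (update f Q b) g ↔ Agree π P Q f g :=
  forall_congr' fun x => forall_congr' fun _ => forall_congr' fun hQ => by rw [update_of_ne hQ]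

theorem agree_update_target [DecidableEq Y] (h : IsMerge π P Q) {f : X → Bool} {g : Y → Bool}
    {b : Bool} :
    Agree π P Q f (update g (π P) b) ↔ Agree π P Q f g :=
  forall_congr' fun x => forall_congr' fun hP => forall_congr' fun hQ => by
    rw [update_of_ne (h.map_ne hP hQ)]

/-- Changing the sign of a circle that does not take part commutes with the merge and split. -/
theorem agree_update_rest [DecidableEq X] [DecidableEq Y] (h : IsMerge π P Q) {f : X → Bool}
    {g : Y → Bool} {x : X} (hP : x ≠ P) (hQ : x ≠ Q) (b : Bool) :
    (g (π x) = !b ∧ Agree π P Q f (update g (π x) b)) ↔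
      (f x = b ∧ Agree π P Q (update f x !b) g) := by
  constructor
  · rintro ⟨h1, h2⟩
    refine ⟨by simpa using (h2 x hP hQ).symm, fun z hzP hzQ => ?_⟩
    rcases eq_or_ne z x with rfl | hz
    · simpa using h1
    · have := h2 z hzP hzQ
      rw [update_of_ne fun h' => hz (h.eq_of_map_eq hzP hzQ h')] at this
      rw [update_of_ne hz, this]
  · rintro ⟨h1, h2⟩
    refine ⟨by simpa using h2 x hP hQ, fun z hzP hzQ => ?_⟩
    rcases eq_or_ne z x with rfl | hz
    · simpa using h1.symm
    · have := h2 z hzP hzQ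
      rw [update_of_ne hz] at this
      rwa [update_of_ne fun h' => hz (h.eq_of_map_eq hzP hzQ h')]

end Update

section Winding

variable [Fintype X] [DecidableEq Y] {wX : X → ℤ} {wY : Y → ℤ}
  (hw : ∀ y, wY y = ∑ x, if π x = y then wX x else 0)
include hw

theorem winding_merged (h : IsMerge π P Q) : wY (π P) = wX P + wX Q := by
  classical
  rw [hw, h.sum_source, if_pos rfl, if_pos h.map_eq.symm, sum_eq_zero, add_zero]
  intro x hx
  rw [mem_filter] at hx
  exact if_neg (h.map_ne hx.2.1 hx.2.2)

theorem winding_rest (h : IsMerge π P Q) {x : X} (hP : x ≠ P) (hQ : x ≠ Q) :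
    wY (π x) = wX x := by
  rw [hw, sum_eq_single x, if_pos rfl]
  · intro z _ hz
    exact if_neg fun h' => hz (h.eq_of_map_eq hP hQ h'.symm).symm
  · simp

/-- The merge map commutes with the lowering operator: the lowering operator is multiplication with
a sum of generators weighted by winding numbers, and these are additive under merges. -/
theorem ladder_mergeEntry [DecidableEq X] [Fintype Y] (h : IsMerge π P Q)
    (f : X → Bool) (g : Y → Bool) :
    ladder wY false (mergeEntry π P Q f) g = ladder wX true (fun f => mergeEntry π P Q f g) f := by
  classical
  change (∑ y, if g y = false then (wY y : ℂ) * mergeEntry π P Q f (update g y true) else 0) =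
      ∑ x, if f x = true then (wX x : ℂ) * mergeEntry π P Q (update f x false) g else 0
  rw [h.sum_target, h.sum_source]
  congr 1
  · simp only [mergeEntry, agree_update_source_left, agree_update_source_right,
      h.agree_update_target, h.winding_merged hw, update_self, update_of_ne h.ne,
      update_of_ne h.ne.symm]
    by_cases hA : Agree π P Q f g
    · simp only [if_pos hA]
      cases f P <;> cases f Q <;> cases g (π P) <;> simp [mergeCoeff]
    · simp [if_neg hA]
  · refine sum_congr rfl fun x hx => ?_
    obtain ⟨-, hP, hQ⟩ := mem_filter.1 hx
    have key := h.agree_update_rest (f := f) (g := g) hP hQ true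
    simp only [mergeEntry, h.winding_rest hw hP hQ, update_of_ne hP.symm, update_of_ne hQ.symm,
      update_of_ne (h.map_ne hP hQ).symm, mul_ite, mul_zero, ← ite_and]
    exact if_congr key rfl rfl

/-- The split map commutes with the lowering operator, because it is a map of bimodules. -/
theorem ladder_splitEntry [DecidableEq X] [Fintype Y] (h : IsMerge π P Q)
    (f : X → Bool) (g : Y → Bool) :
    ladder wX false (splitEntry π P Q g) f = ladder wY true (fun g => splitEntry π P Q g f) g := by
  classical
  change (∑ x, if f x = false then (wX x : ℂ) * splitEntry π P Q g (update f x true) else 0) =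
      ∑ y, if g y = true then (wY y : ℂ) * splitEntry π P Q (update g y false) f else 0
  rw [h.sum_target, h.sum_source]
  congr 1
  · simp only [splitEntry, agree_update_source_left, agree_update_source_right,
      h.agree_update_target, h.winding_merged hw, update_self, update_of_ne h.ne,
      update_of_ne h.ne.symm]
    by_cases hA : Agree π P Q f g
    · simp only [if_pos hA]
      cases f P <;> cases f Q <;> cases g (π P) <;> simp [splitCoeff]
    · simp [if_neg hA]
  · refine sum_congr rfl fun x hx => ?_
    obtain ⟨-, hP, hQ⟩ := mem_filter.1 hx
    have key := h.agree_update_rest (f := f) (g := g) hP hQ false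
    simp only [splitEntry, h.winding_rest hw hP hQ, update_of_ne hP.symm, update_of_ne hQ.symm,
      update_of_ne (h.map_ne hP hQ).symm, mul_ite, mul_zero, ← ite_and]
    exact if_congr key.symm rfl rfl

end Winding

section Reverse

variable [DecidableEq Y] [Fintype X] {wX : X → ℤ} {wY : Y → ℤ}
  (hw : ∀ y, wY y = ∑ x, if π x = y then wX x else 0)
include hw

theorem agree_reverse (h : IsMerge π P Q) {f : X → Bool} {g : Y → Bool} :
    Agree π P Q (reverse wX f) (reverse wY g) ↔ Agree π P Q f g :=
  forall_congr' fun x => forall_congr' fun hP => forall_congr' fun hQ => by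
    unfold reverse
    rw [h.winding_rest hw hP hQ]
    split <;> simp

theorem weight_eq_iff [Fintype Y] (h : IsMerge π P Q) {f : X → Bool} {g : Y → Bool}
    (hA : Agree π P Q f g) :
    weight wX f = weight wY g ↔
      wX P ^ 2 * (if f P then 1 else -1) + wX Q ^ 2 * (if f Q then 1 else -1) =
        (wX P + wX Q) ^ 2 * if g (π P) then 1 else -1 := by
  classical
  unfold weight
  rw [h.sum_source, h.sum_target, h.winding_merged hw, sum_congr rfl fun x hx => ?_,
    add_left_inj]
  obtain ⟨-, hP, hQ⟩ := mem_filter.1 hx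
  rw [h.winding_rest hw hP hQ, hA x hP hQ]

variable (hX : ∀ x, wX x = -1 ∨ wX x = 0 ∨ wX x = 1) (hY : ∀ y, wY y = -1 ∨ wY y = 0 ∨ wY y = 1)
include hX hY

/-- The part of the merge map that preserves the weight is symmetric under the reversal of the
signs of all circles with nonzero winding number. -/
theorem mergeEntry_reverse [Fintype Y] (h : IsMerge π P Q) (f : X → Bool) (g : Y → Bool)
    (hfg : weight wX f = weight wY g) :
    mergeEntry π P Q (reverse wX f) (reverse wY g) = mergeEntry π P Q f g := by
  classical
  unfold mergeEntry
  rw [if_congr (h.agree_reverse hw) rfl rfl]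
  by_cases hA : Agree π P Q f g
  · rw [if_pos hA, if_pos hA]
    rw [h.weight_eq_iff hw hA] at hfg
    have hR := hY (π P)
    rw [h.winding_merged hw] at hR
    unfold reverse
    rw [h.winding_merged hw]
    generalize f P = a at *
    generalize f Q = b at *
    generalize g (π P) = c at *
    rcases hX P with h1 | h1 | h1 <;> rcases hX Q with h2 | h2 | h2 <;> rw [h1, h2] at hR hfg ⊢ <;>
    cases a <;> cases b <;> cases c <;> simp [mergeCoeff] at hR hfg ⊢
  · rw [if_neg hA, if_neg hA]

/-- The part of the split map that preserves the weight is symmetric under the reversal of the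
signs of all circles with nonzero winding number. -/
theorem splitEntry_reverse [Fintype Y] (h : IsMerge π P Q) (f : X → Bool) (g : Y → Bool)
    (hfg : weight wX f = weight wY g) :
    splitEntry π P Q (reverse wY g) (reverse wX f) = splitEntry π P Q g f := by
  classical
  unfold splitEntry
  rw [if_congr (h.agree_reverse hw) rfl rfl]
  by_cases hA : Agree π P Q f g
  · rw [if_pos hA, if_pos hA]
    rw [h.weight_eq_iff hw hA] at hfg
    have hR := hY (π P)
    rw [h.winding_merged hw] at hR
    unfold reverse
    rw [h.winding_merged hw]
    generalize f P = a at *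
    generalize f Q = b at *
    generalize g (π P) = c at *
    rcases hX P with h1 | h1 | h1 <;> rcases hX Q with h2 | h2 | h2 <;> rw [h1, h2] at hR hfg ⊢ <;>
    cases a <;> cases b <;> cases c <;> simp [splitCoeff] at hR hfg ⊢
  · rw [if_neg hA, if_neg hA]

end Reverse

end IsMerge

/-! ### The ladder operators on the Khovanov complex -/

namespace AnnularDiagram

open Signs

variable {D : AnnularDiagram}

/-- The map of circles induced by the identity on points, if all that happens to the circles is that
those through `a` and `e` are merged. -/
theorem exists_isMerge {s₁ s₂ : D.CubeVertex} {a e : D.Point}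
    (hne : (Quot.mk _ a : D.StateCircle s₁) ≠ Quot.mk _ e)
    (heq : (Quot.mk _ a : D.StateCircle s₂) = Quot.mk _ e)
    (h₁ : ∀ p q : D.Point, (Quot.mk _ p : D.StateCircle s₁) ≠ Quot.mk _ a →
      (Quot.mk _ p : D.StateCircle s₁) ≠ Quot.mk _ e →
      ((Quot.mk _ p : D.StateCircle s₁) = Quot.mk _ q ↔
        (Quot.mk _ p : D.StateCircle s₂) = Quot.mk _ q))
    (h₂ : ∀ p q : D.Point, (Quot.mk _ p : D.StateCircle s₂) ≠ Quot.mk _ a →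
      (Quot.mk _ p : D.StateCircle s₂) ≠ Quot.mk _ e →
      ((Quot.mk _ p : D.StateCircle s₁) = Quot.mk _ q ↔
        (Quot.mk _ p : D.StateCircle s₂) = Quot.mk _ q)) :
    ∃ π : D.StateCircle s₁ → D.StateCircle s₂, (∀ p, π (Quot.mk _ p) = Quot.mk _ p) ∧
      IsMerge π (Quot.mk _ a) (Quot.mk _ e) := by
  have hae : ∀ p : D.Point, (Quot.mk _ p : D.StateCircle s₂) = Quot.mk _ a ↔
      ((Quot.mk _ p : D.StateCircle s₁) = Quot.mk _ a ∨
        (Quot.mk _ p : D.StateCircle s₁) = Quot.mk _ e) := by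
    intro p
    constructor
    · intro h
      by_contra! h'
      exact h'.1 ((h₁ p a h'.1 h'.2).2 h)
    · intro h
      by_contra h'
      rcases h with h | h
      · exact h' ((h₂ p a h' (heq ▸ h')).1 h)
      · exact h' (((h₂ p e h' (heq ▸ h')).1 h).trans heq.symm)
  have hsound : ∀ p q : D.Point, D.Joined s₁ p q →
      (Quot.mk _ p : D.StateCircle s₂) = Quot.mk _ q := by
    intro p q h
    have hpq : (Quot.mk _ p : D.StateCircle s₁) = Quot.mk _ q := Quot.sound h
    by_cases hp : (Quot.mk _ p : D.StateCircle s₂) = Quot.mk _ a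
    · rw [hp, (hae q).2 (hpq ▸ (hae p).1 hp)]
    · exact (h₂ p q hp (heq ▸ hp)).1 hpq
  refine ⟨Quot.lift (fun p => Quot.mk _ p) hsound, fun p => rfl, hne, heq, ?_, ?_⟩
  · rintro ⟨p⟩
    exact ⟨Quot.mk _ p, rfl⟩
  · rintro ⟨p⟩ ⟨q⟩ (hpq : (Quot.mk _ p : D.StateCircle s₂) = Quot.mk _ q)
    by_cases hp : (Quot.mk _ p : D.StateCircle s₂) = Quot.mk _ a
    · have hq := hpq.symm.trans hp
      rcases (hae p).1 hp with h | h <;> rcases (hae q).1 hq with h' | h'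
      · exact Or.inl (h.trans h'.symm)
      · exact Or.inr (Or.inl ⟨h, h'⟩)
      · exact Or.inr (Or.inr ⟨h, h'⟩)
      · exact Or.inl (h.trans h'.symm)
    · exact Or.inl ((h₂ p q hp (heq ▸ hp)).2 hpq)

open Classical in
theorem winding_map {s₁ s₂ : D.CubeVertex} {π : D.StateCircle s₁ → D.StateCircle s₂}
    (hπ : ∀ p, π (Quot.mk _ p) = Quot.mk _ p) (y : D.StateCircle s₂) :
    winding s₂ y = ∑ x, if π x = y then winding s₁ x else 0 := by
  simp only [winding, ← sum_filter (s := univ) (p := fun x => π x = y)]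
  rw [sum_comm]
  refine sum_congr rfl fun j _ => ?_
  rw [sum_ite_eq]
  refine if_congr ?_ rfl rfl
  simp [hπ]

theorem kGrading_eq_weight (S : D.EnhancedState) :
    S.kGrading = weight (winding S.1) S.2 := by
  refine sum_congr rfl fun C _ => ?_
  by_cases h : D.Nontrivial S.1 C
  · have h0 := nontrivial_iff_winding_ne_zero.1 h
    rw [if_pos h]
    rcases winding_eq_neg_one_or_zero_or_one S.1 C with h1 | h1 | h1 <;>
      rw [h1] at h0 ⊢ <;> simp at h0 ⊢
  · have h0 := nontrivial_iff_winding_ne_zero.not.1 h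
    rw [if_neg h, not_not.1 h0]
    simp

/-- At an edge of the cube of resolutions, the matrix entries of the Khovanov differential are those
of a merge map or those of a split map. -/
theorem IsEdge.saddleCoeff_eq {c : D.Crossing} {s s' : D.CubeVertex} (h : IsEdge c s s') :
    (∃ (π : D.StateCircle s → D.StateCircle s') (P Q : D.StateCircle s), IsMerge π P Q ∧
      (∀ p, π (Quot.mk _ p) = Quot.mk _ p) ∧
      ∀ f g, saddleCoeff c ⟨s, f⟩ ⟨s', g⟩ = IsMerge.mergeEntry π P Q f g) ∨
    (∃ (π : D.StateCircle s' → D.StateCircle s) (P Q : D.StateCircle s'), IsMerge π P Q ∧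
      (∀ p, π (Quot.mk _ p) = Quot.mk _ p) ∧
      ∀ f g, saddleCoeff c ⟨s, f⟩ ⟨s', g⟩ = IsMerge.splitEntry π P Q f g) := by
  classical
  by_cases hPQ : (Quot.mk _ c.corner : D.StateCircle s) = Quot.mk _ c.oppositeCorner
  · right
    obtain ⟨π, hπ, hm⟩ := exists_isMerge (s₁ := s') (s₂ := s) (h.mk_corner_eq_iff.1 hPQ) hPQ
      (fun p q h1 h2 => (h.mk_eq_iff' q h1 h2).symm) (fun p q h1 h2 => (h.mk_eq_iff q h1 h2).symm)
    refine ⟨π, _, _, hm, hπ, fun f g => ?_⟩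
    unfold saddleCoeff IsMerge.splitEntry
    simp only [if_pos hPQ]
    refine if_congr ?_ ?_ rfl
    · constructor
      · rintro H ⟨p⟩ hP hQ
        have := hm.map_ne hP hQ
        rw [hπ] at this ⊢
        rw [hπ] at this
        exact (H p this (hPQ ▸ this)).symm
      · intro H p hP hQ
        have := H (Quot.mk _ p) (fun h' => hP ?_) (fun h' => hQ ?_)
        · rw [hπ] at this
          exact this.symm
        · rw [← hπ, h', hπ]
        · rw [← hπ, h', hπ]
    · rw [hπ]
      rfl
  · left
    obtain ⟨π, hπ, hm⟩ := exists_isMerge (s₁ := s) (s₂ := s') hPQ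
      (by_contra fun h' => hPQ (h.mk_corner_eq_iff.2 h'))
      (fun p q h1 h2 => h.mk_eq_iff q h1 h2) (fun p q h1 h2 => h.mk_eq_iff' q h1 h2)
    refine ⟨π, _, _, hm, hπ, fun f g => ?_⟩
    unfold saddleCoeff IsMerge.mergeEntry
    simp only [if_neg hPQ]
    refine if_congr ?_ ?_ rfl
    · constructor
      · rintro H ⟨p⟩ hP hQ
        have := H p hP hQ
        rw [hπ]
        exact this
      · intro H p hP hQ
        have := H (Quot.mk _ p) hP hQ
        rw [hπ] at this
        exact this
    · rw [hπ]
      rfl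

open Classical in
/-- The raising operator (for `b = true`) and the lowering operator (for `b = false`) of the
`sl₂`-action on the Khovanov complex. -/
noncomputable def ladderMap (D : AnnularDiagram) (b : Bool) : D.CKh →ₗ[ℂ] D.CKh where
  toFun x S := ladder (winding S.1) b (fun f => x ⟨S.1, f⟩) S.2
  map_add' x y := by
    ext S
    simp only [ladder, Pi.add_apply, ← sum_add_distrib]
    refine sum_congr rfl fun C _ => ?_
    split <;> ring
  map_smul' a x := by
    ext S
    simp only [ladder, Pi.smul_apply, smul_eq_mul, RingHom.id_apply, mul_sum]
    refine sum_congr rfl fun C _ => ?_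
    split <;> ring

open Classical in
theorem ladderMap_apply (b : Bool) (x : D.CKh) (S : D.EnhancedState) :
    D.ladderMap b x S = ladder (winding S.1) b (fun f => x ⟨S.1, f⟩) S.2 := rfl

/-- The enhanced state with reversed signs on the nontrivial circles. -/
noncomputable def EnhancedState.reverse (S : D.EnhancedState) : D.EnhancedState :=
  ⟨S.1, Signs.reverse (winding S.1) S.2⟩

theorem EnhancedState.reverse_reverse (S : D.EnhancedState) : S.reverse.reverse = S := by
  simp [reverse, Signs.reverse_reverse]

theorem EnhancedState.kGrading_reverse (S : D.EnhancedState) :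
    S.reverse.kGrading = -S.kGrading := by
  rw [kGrading_eq_weight, kGrading_eq_weight]
  exact weight_reverse _ _

/-- The involution of the Khovanov complex that reverses the signs of all nontrivial circles. -/
noncomputable def reverseMap (D : AnnularDiagram) : D.CKh →ₗ[ℂ] D.CKh :=
  LinearMap.funLeft ℂ ℂ EnhancedState.reverse

theorem reverseMap_apply (x : D.CKh) (S : D.EnhancedState) : D.reverseMap x S = x S.reverse := rfl

theorem reverseMap_reverseMap (x : D.CKh) : D.reverseMap (D.reverseMap x) = x := by
  ext S
  rw [reverseMap_apply, reverseMap_apply, S.reverse_reverse]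

/-- The operator that multiplies every enhanced state with its `k`-grading. -/
noncomputable def gradingMap (D : AnnularDiagram) : D.CKh →ₗ[ℂ] D.CKh where
  toFun x S := (S.kGrading : ℂ) * x S
  map_add' x y := by ext S; simp [mul_add]
  map_smul' a x := by ext S; simp [mul_left_comm]

theorem ladderMap_commutator (x : D.CKh) :
    D.ladderMap true (D.ladderMap false x) - D.ladderMap false (D.ladderMap true x) =
      D.gradingMap x := by
  classical
  ext S
  have := ladder_commutator (winding S.1) (fun f => x ⟨S.1, f⟩) S.2
  rw [← kGrading_eq_weight] at this
  exact this

theorem ladderMap_true (x : D.CKh) :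
    D.ladderMap true x = D.reverseMap (D.ladderMap false (D.reverseMap x)) := by
  classical
  ext S
  have := ladder_true_eq (winding S.1) (fun f => x ⟨S.1, f⟩) S.2
  exact this

theorem sum_mul_ladderMap (a x : D.CKh) :
    ∑ S, a S * D.ladderMap false x S = ∑ S, D.ladderMap true a S * x S := by
  classical
  have key : ∀ φ : D.EnhancedState → ℂ, ∑ S, φ S = ∑ s, ∑ f, φ ⟨s, f⟩ := by
    intro φ
    rw [← Fintype.sum_sigma']
    exact sum_congr (by ext; simp) fun _ _ => rfl
  rw [key, key]
  refine sum_congr rfl fun s _ => ?_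
  have := sum_mul_ladder (winding s) (fun f => a ⟨s, f⟩) (fun f => x ⟨s, f⟩)
  exact this

end AnnularDiagram

/-! ### Compatibility with the sutured differential -/

namespace AnnularDiagram

open Signs

variable {D : AnnularDiagram}

/-- The ladder operators act on each vertex of the cube of resolutions separately. -/
theorem ladderMap_eq_mul {b : Bool} {x y : D.CKh} {S : D.EnhancedState} {a : ℂ}
    (h : ∀ f, x ⟨S.1, f⟩ = a * y ⟨S.1, f⟩) : D.ladderMap b x S = a * D.ladderMap b y S := by
  classical
  rw [ladderMap_apply, ladderMap_apply, ladder, ladder, mul_sum]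
  refine sum_congr rfl fun C _ => ?_
  rw [h, mul_ite, mul_zero, mul_left_comm]

theorem ladderMap_false_restrict (x : D.CKh) (k : ℤ) (S : D.EnhancedState) :
    D.ladderMap false (fun T => if T.kGrading = k then x T else 0) S =
      if S.kGrading + 2 = k then D.ladderMap false x S else 0 := by
  classical
  rw [ladderMap_apply, ladderMap_apply, ladder, ladder]
  trans ∑ C, if S.kGrading + 2 = k then if S.2 C = false then
    (winding S.1 C : ℂ) * x ⟨S.1, update S.2 C true⟩ else 0 else 0
  swap
  · split_ifs <;> simp
  refine sum_congr rfl fun C _ => ?_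
  by_cases hC : S.2 C = false
  · have hk := weight_update_true (winding S.1) hC
    simp only [kGrading_eq_weight, Bool.not_false, hk]
    rcases winding_eq_neg_one_or_zero_or_one S.1 C with h | h | h <;> rw [h] <;> simp [hC]
  · simp [hC]

theorem ladderMap_true_restrict (x : D.CKh) (k : ℤ) (S : D.EnhancedState) :
    D.ladderMap true (fun T => if k = T.kGrading then x T else 0) S =
      if k + 2 = S.kGrading then D.ladderMap true x S else 0 := by
  classical
  rw [ladderMap_apply, ladderMap_apply, ladder, ladder]
  trans ∑ C, if k + 2 = S.kGrading then if S.2 C = true then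
    (winding S.1 C : ℂ) * x ⟨S.1, update S.2 C false⟩ else 0 else 0
  swap
  · split_ifs <;> simp
  refine sum_congr rfl fun C _ => ?_
  by_cases hC : S.2 C = true
  · have hk := weight_update_false (winding S.1) hC
    simp only [kGrading_eq_weight, Bool.not_true, hk]
    rcases winding_eq_neg_one_or_zero_or_one S.1 C with h | h | h <;> rw [h] <;>
      simp [hC, eq_sub_iff_add_eq]
  · simp [hC]

theorem ladderMap_saddleCoeff {c : D.Crossing} {S T : D.EnhancedState} (h : IsEdge c S.1 T.1) :
    D.ladderMap false (saddleCoeff c S) T =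
      D.ladderMap true (fun S => saddleCoeff c S T) S := by
  classical
  obtain ⟨s, f⟩ := S
  obtain ⟨s', g⟩ := T
  rw [ladderMap_apply, ladderMap_apply]
  rcases h.saddleCoeff_eq with ⟨π, P, Q, hm, hπ, hc⟩ | ⟨π, P, Q, hm, hπ, hc⟩
  · simp only [hc]
    exact hm.ladder_mergeEntry (winding_map hπ) f g
  · simp only [hc]
    exact hm.ladder_splitEntry (winding_map hπ) g f

/-- The lowering operator commutes with the full Khovanov differential. -/
theorem ladderMap_khovanovCoeff (S T : D.EnhancedState) :
    D.ladderMap false (khovanovCoeff S) T =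
      D.ladderMap true (fun S => khovanovCoeff S T) S := by
  classical
  have h1 : (khovanovCoeff S : D.CKh) = ∑ c : D.Crossing, fun T : D.EnhancedState =>
      if S.1 c = false ∧ T.1 = Function.update S.1 c true then
        (-1) ^ (Nat.card {b : D.Crossing // b < c ∧ S.1 b = true}) * saddleCoeff c S T
      else 0 := by
    ext T
    rw [Finset.sum_apply]
    rfl
  have h2 : (fun S => khovanovCoeff S T : D.CKh) = ∑ c : D.Crossing, fun S : D.EnhancedState =>
      if S.1 c = false ∧ T.1 = Function.update S.1 c true then
        (-1) ^ (Nat.card {b : D.Crossing // b < c ∧ S.1 b = true}) * saddleCoeff c S T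
      else 0 := by
    ext S
    rw [Finset.sum_apply]
    rfl
  rw [h1, h2, map_sum, map_sum, Finset.sum_apply, Finset.sum_apply]
  refine sum_congr rfl fun c _ => ?_
  by_cases h : S.1 c = false ∧ T.1 = Function.update S.1 c true
  · have he : IsEdge c S.1 T.1 := h.2 ▸ isEdge_update h.1
    let sign : ℂ := (-1) ^ (Nat.card {b : D.Crossing // b < c ∧ S.1 b = true})
    refine (ladderMap_eq_mul (a := sign) (y := saddleCoeff c S) fun g => if_pos h).trans
      (Eq.trans ?_ (ladderMap_eq_mul (a := sign) (y := fun S => saddleCoeff c S T)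
        fun g => if_pos h).symm)
    rw [ladderMap_saddleCoeff he]
  · refine (ladderMap_eq_mul (a := 0) (y := 0) fun g => (if_neg h).trans (zero_mul _).symm).trans
      (Eq.trans ?_ (ladderMap_eq_mul (a := 0) (y := 0)
        fun g => (if_neg h).trans (zero_mul _).symm).symm)
    rw [zero_mul, zero_mul]

open Classical in
/-- The matrix entries of the sutured differential. -/
noncomputable def suturedCoeff (S T : D.EnhancedState) : ℂ :=
  if T.kGrading = S.kGrading then khovanovCoeff S T else 0

theorem suturedDifferential_apply (x : D.CKh) (T : D.EnhancedState) :
    D.suturedDifferential x T = ∑ S, suturedCoeff S T * x S := rfl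

theorem ladderMap_suturedCoeff (S T : D.EnhancedState) :
    D.ladderMap false (suturedCoeff S) T = D.ladderMap true (fun S => suturedCoeff S T) S := by
  classical
  refine (ladderMap_false_restrict (khovanovCoeff S) S.kGrading T).trans ?_
  refine Eq.trans ?_ (ladderMap_true_restrict (fun S => khovanovCoeff S T) T.kGrading S).symm
  rw [ladderMap_khovanovCoeff]

theorem ladderMap_false_suturedDifferential (x : D.CKh) :
    D.ladderMap false (D.suturedDifferential x) = D.suturedDifferential (D.ladderMap false x) := by
  have h : D.suturedDifferential x = ∑ S, x S • (suturedCoeff S : D.CKh) := by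
    ext T
    rw [suturedDifferential_apply, Finset.sum_apply]
    exact sum_congr rfl fun S _ => mul_comm _ _
  ext T
  rw [h, map_sum, Finset.sum_apply, suturedDifferential_apply, sum_mul_ladderMap]
  refine sum_congr rfl fun S _ => ?_
  rw [map_smul, Pi.smul_apply, smul_eq_mul, mul_comm, ladderMap_suturedCoeff]

theorem saddleCoeff_reverse {c : D.Crossing} {S T : D.EnhancedState} (h : IsEdge c S.1 T.1)
    (hST : T.kGrading = S.kGrading) :
    saddleCoeff c S.reverse T.reverse = saddleCoeff c S T := by
  classical
  obtain ⟨s, f⟩ := S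
  obtain ⟨s', g⟩ := T
  rw [kGrading_eq_weight, kGrading_eq_weight] at hST
  rcases h.saddleCoeff_eq with ⟨π, P, Q, hm, hπ, hc⟩ | ⟨π, P, Q, hm, hπ, hc⟩
  · simp only [EnhancedState.reverse, hc]
    exact hm.mergeEntry_reverse (winding_map hπ) (winding_eq_neg_one_or_zero_or_one s)
      (winding_eq_neg_one_or_zero_or_one s') f g hST.symm
  · simp only [EnhancedState.reverse, hc]
    exact hm.splitEntry_reverse (winding_map hπ) (winding_eq_neg_one_or_zero_or_one s')
      (winding_eq_neg_one_or_zero_or_one s) g f hST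

theorem suturedCoeff_reverse (S T : D.EnhancedState) :
    suturedCoeff S.reverse T.reverse = suturedCoeff S T := by
  classical
  unfold suturedCoeff
  rw [S.kGrading_reverse, T.kGrading_reverse]
  simp only [neg_inj]
  by_cases hST : T.kGrading = S.kGrading
  · rw [if_pos hST, if_pos hST]
    refine sum_congr rfl fun c _ => ?_
    change (if S.1 c = false ∧ T.1 = Function.update S.1 c true then
        (-1) ^ (Nat.card {b : D.Crossing // b < c ∧ S.1 b = true}) *
          saddleCoeff c S.reverse T.reverse
      else 0) = _
    by_cases h : S.1 c = false ∧ T.1 = Function.update S.1 c true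
    · have he : IsEdge c S.1 T.1 := h.2 ▸ isEdge_update h.1
      rw [saddleCoeff_reverse he hST]
    · rw [if_neg h, if_neg h]
  · rw [if_neg hST, if_neg hST]

theorem reverseMap_suturedDifferential (x : D.CKh) :
    D.reverseMap (D.suturedDifferential x) = D.suturedDifferential (D.reverseMap x) := by
  have hinv : Involutive (EnhancedState.reverse (D := D)) := EnhancedState.reverse_reverse
  ext T
  rw [reverseMap_apply, suturedDifferential_apply, suturedDifferential_apply,
    ← Equiv.sum_comp hinv.toPerm]
  refine sum_congr rfl fun S _ => ?_
  rw [reverseMap_apply]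
  exact congrArg (· * _) (suturedCoeff_reverse S T)

theorem ladderMap_suturedDifferential (b : Bool) (x : D.CKh) :
    D.ladderMap b (D.suturedDifferential x) = D.suturedDifferential (D.ladderMap b x) := by
  cases b
  · exact ladderMap_false_suturedDifferential x
  · rw [ladderMap_true, ladderMap_true, reverseMap_suturedDifferential,
      ladderMap_false_suturedDifferential, reverseMap_suturedDifferential]

theorem gradingMap_suturedDifferential (x : D.CKh) :
    D.gradingMap (D.suturedDifferential x) = D.suturedDifferential (D.gradingMap x) := by
  simp only [← ladderMap_commutator, map_sub, ladderMap_suturedDifferential]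

/-! ### Weight spaces -/

theorem mem_chainsOfWeight_iff {k : ℤ} {x : D.CKh} :
    x ∈ D.chainsOfWeight k ↔ D.gradingMap x = (k : ℂ) • x := by
  constructor
  · intro h
    ext S
    change (S.kGrading : ℂ) * x S = k * x S
    by_cases hS : x S = 0
    · simp [hS]
    · rw [h S hS]
  · intro h S hS
    have := congrFun h S
    exact_mod_cast mul_right_cancel₀ hS (show (S.kGrading : ℂ) * x S = k * x S from this)

theorem gradingMap_ladderMap_false (x : D.CKh) :
    D.gradingMap (D.ladderMap false x) =
      D.ladderMap false (D.gradingMap x) - (2 : ℂ) • D.ladderMap false x := by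
  classical
  ext S
  change (S.kGrading : ℂ) * D.ladderMap false x S =
    D.ladderMap false (D.gradingMap x) S - 2 * D.ladderMap false x S
  rw [ladderMap_apply, ladderMap_apply, ladder, ladder, mul_sum, mul_sum, ← sum_sub_distrib]
  refine sum_congr rfl fun C _ => ?_
  by_cases hC : S.2 C = false
  · have hk := weight_update_true (winding S.1) hC
    rw [if_pos hC, if_pos hC]
    change _ = (winding S.1 C : ℂ) *
      ((EnhancedState.kGrading (D := D) ⟨S.1, update S.2 C true⟩ : ℂ) * _) - _
    simp only [kGrading_eq_weight, Bool.not_false, hk]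
    rcases winding_eq_neg_one_or_zero_or_one S.1 C with h | h | h <;> rw [h] <;> push_cast <;> ring
  · simp [hC]

theorem gradingMap_reverseMap (x : D.CKh) :
    D.gradingMap (D.reverseMap x) = -D.reverseMap (D.gradingMap x) := by
  ext S
  change (S.kGrading : ℂ) * x S.reverse = -((S.reverse.kGrading : ℂ) * x S.reverse)
  rw [S.kGrading_reverse]
  push_cast
  ring

theorem gradingMap_ladderMap_true (x : D.CKh) :
    D.gradingMap (D.ladderMap true x) =
      D.ladderMap true (D.gradingMap x) + (2 : ℂ) • D.ladderMap true x := by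
  rw [ladderMap_true, ladderMap_true, gradingMap_reverseMap, gradingMap_ladderMap_false,
    gradingMap_reverseMap]
  simp only [map_sub, map_neg, map_smul]
  abel

/-! ### The action on sutured annular Khovanov homology -/

/-- The map on homology that is induced by a chain map. -/
noncomputable def homologyMap (φ : D.CKh →ₗ[ℂ] D.CKh)
    (h : ∀ x, φ (D.suturedDifferential x) = D.suturedDifferential (φ x)) : D.SKh →ₗ[ℂ] D.SKh :=
  Submodule.mapQ _ _
    (φ.restrict (p := LinearMap.ker D.suturedDifferential)
      (q := LinearMap.ker D.suturedDifferential) fun x hx => by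
        rw [LinearMap.mem_ker] at hx ⊢
        rw [← h, hx, map_zero]) <| by
    rintro ⟨_, _⟩ ⟨y, rfl⟩
    exact ⟨φ y, (h y).symm⟩

/-- The homology class of a cycle. -/
noncomputable def homologyClass (x : D.CKh) (hx : D.suturedDifferential x = 0) : D.SKh :=
  Submodule.Quotient.mk ⟨x, hx⟩

theorem exists_homologyClass (y : D.SKh) : ∃ x hx, homologyClass x hx = y := by
  obtain ⟨⟨x, hx⟩, rfl⟩ := Submodule.Quotient.mk_surjective _ y
  exact ⟨x, hx, rfl⟩

theorem homologyMap_homologyClass {φ : D.CKh →ₗ[ℂ] D.CKh}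
    (h : ∀ x, φ (D.suturedDifferential x) = D.suturedDifferential (φ x)) {x : D.CKh}
    (hx : D.suturedDifferential x = 0) :
    homologyMap φ h (homologyClass x hx) =
      homologyClass (φ x) (by rw [← h, hx, map_zero]) := rfl

theorem mem_SKhOfWeight_iff {k : ℤ} {y : D.SKh} :
    y ∈ D.SKhOfWeight k ↔ ∃ x ∈ D.chainsOfWeight k, ∃ hx, homologyClass x hx = y := by
  constructor
  · rintro ⟨⟨x, hx⟩, hk, rfl⟩
    exact ⟨x, hk, hx, rfl⟩
  · rintro ⟨x, hk, hx, rfl⟩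
    exact ⟨⟨x, hx⟩, hk, rfl⟩

/-- The raising and the lowering operator on homology. -/
noncomputable def homologyLadder (D : AnnularDiagram) (b : Bool) : Module.End ℂ D.SKh :=
  homologyMap (D.ladderMap b) (ladderMap_suturedDifferential b)

/-- The operator on homology that acts as multiplication by `k` in the `k`-grading `k`. -/
noncomputable def homologyGrading (D : AnnularDiagram) : Module.End ℂ D.SKh :=
  homologyMap D.gradingMap gradingMap_suturedDifferential

theorem homologyGrading_apply {k : ℤ} {y : D.SKh} (hy : y ∈ D.SKhOfWeight k) :
    D.homologyGrading y = (k : ℂ) • y := by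
  obtain ⟨x, hk, hx, rfl⟩ := mem_SKhOfWeight_iff.1 hy
  rw [homologyGrading, homologyMap_homologyClass]
  simp only [mem_chainsOfWeight_iff.1 hk]
  rfl

theorem homologyLadder_commutator :
    D.homologyLadder true * D.homologyLadder false -
      D.homologyLadder false * D.homologyLadder true = D.homologyGrading := by
  refine LinearMap.ext fun y => ?_
  obtain ⟨x, hx, rfl⟩ := exists_homologyClass y
  simp only [homologyGrading, homologyMap_homologyClass, ← ladderMap_commutator]
  rfl

theorem homologyGrading_commutator_true :
    D.homologyGrading * D.homologyLadder true -
      D.homologyLadder true * D.homologyGrading = 2 • D.homologyLadder true := by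
  have h : ∀ x : D.CKh, (2 : ℕ) • D.ladderMap true x =
      D.gradingMap (D.ladderMap true x) - D.ladderMap true (D.gradingMap x) := by
    intro x
    rw [gradingMap_ladderMap_true, add_sub_cancel_left, ← Nat.cast_smul_eq_nsmul ℂ]
    rfl
  refine LinearMap.ext fun y => ?_
  obtain ⟨x, hx, rfl⟩ := exists_homologyClass y
  have h2 : (2 • D.homologyLadder true) (homologyClass x hx) =
    homologyClass (2 • D.ladderMap true x) (by
      rw [map_nsmul, ← ladderMap_suturedDifferential, hx, map_zero, smul_zero]) := rfl
  rw [h2]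
  simp only [h]
  rfl

theorem homologyGrading_commutator_false :
    D.homologyGrading * D.homologyLadder false -
      D.homologyLadder false * D.homologyGrading = -(2 • D.homologyLadder false) := by
  have h : ∀ x : D.CKh, -((2 : ℕ) • D.ladderMap false x) =
      D.gradingMap (D.ladderMap false x) - D.ladderMap false (D.gradingMap x) := by
    intro x
    rw [gradingMap_ladderMap_false, sub_sub_cancel_left, ← Nat.cast_smul_eq_nsmul ℂ]
    rfl
  refine LinearMap.ext fun y => ?_
  obtain ⟨x, hx, rfl⟩ := exists_homologyClass y
  have h2 : (-(2 • D.homologyLadder false)) (homologyClass x hx) =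
    homologyClass (-(2 • D.ladderMap false x)) (by
      rw [map_neg, map_nsmul, ← ladderMap_suturedDifferential, hx, map_zero, smul_zero,
        neg_zero]) := rfl
  rw [h2]
  simp only [h]
  rfl

theorem homologyLadder_false_mem {k : ℤ} {y : D.SKh} (hy : y ∈ D.SKhOfWeight k) :
    D.homologyLadder false y ∈ D.SKhOfWeight (k - 2) := by
  obtain ⟨x, hk, hx, rfl⟩ := mem_SKhOfWeight_iff.1 hy
  refine mem_SKhOfWeight_iff.2 ⟨D.ladderMap false x, ?_, _, rfl⟩
  rw [mem_chainsOfWeight_iff] at hk ⊢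
  rw [gradingMap_ladderMap_false, hk, map_smul, ← sub_smul]
  push_cast
  rfl

/-- The lowering operator of a finite-dimensional representation of `sl₂` is injective in positive
weights: a vector of weight `k` in its kernel is a primitive vector of weight `-k` for the opposite
`sl₂`-triple, so that `-k` is a natural number. -/
theorem _root_.Module.End.eq_zero_of_lowering_eq_zero {V : Type*} [AddCommGroup V] [Module ℂ V]
    [FiniteDimensional ℂ V] {h e f : Module.End ℂ V} (hef : e * f - f * e = h)
    (hhe : h * e - e * h = 2 • e) (hhf : h * f - f * h = -(2 • f)) {k : ℤ} (hk : 0 < k) {y : V}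
    (hy : h y = (k : ℂ) • y) (hf : f y = 0) : y = 0 := by
  let : LieRing (Module.End ℂ V) := LieRing.ofAssociativeRing
  by_contra hne
  have ht : IsSl2Triple h e f :=
    { h_ne_zero := by
        intro h0
        rw [h0, LinearMap.zero_apply] at hy
        have := smul_eq_zero.1 hy.symm
        simp [hk.ne', hne] at this
      lie_e_f := hef
      lie_h_e_nsmul := hhe
      lie_h_f_nsmul := hhf }
  have hp : ht.symm.HasPrimitiveVectorWith y (-(k : ℂ)) :=
    { ne_zero := hne
      lie_h := by
        change (-h) y = _
        rw [LinearMap.neg_apply, hy, neg_smul]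
      lie_e := hf }
  obtain ⟨n, hn⟩ := hp.exists_nat
  have : -k = n := by exact_mod_cast hn
  omega

theorem eq_zero_of_homologyLadder_false {k : ℤ} (hk : 0 < k) {y : D.SKh}
    (hy : y ∈ D.SKhOfWeight k) (h : D.homologyLadder false y = 0) : y = 0 :=
  Module.End.eq_zero_of_lowering_eq_zero homologyLadder_commutator
    homologyGrading_commutator_true homologyGrading_commutator_false hk
    (homologyGrading_apply hy) h

theorem finrank_SKhOfWeight_le_sub_two {k : ℤ} (hk : 0 < k) :
    Module.finrank ℂ (D.SKhOfWeight k) ≤ Module.finrank ℂ (D.SKhOfWeight (k - 2)) := by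
  refine LinearMap.finrank_le_finrank_of_injective
    (f := (D.homologyLadder false).restrict fun y hy => homologyLadder_false_mem hy) ?_
  rw [← LinearMap.ker_eq_bot, LinearMap.ker_eq_bot']
  rintro ⟨y, hy⟩ h
  exact Subtype.ext (eq_zero_of_homologyLadder_false hk hy (congrArg Subtype.val h))

theorem finrank_SKhOfWeight_le_neg (k : ℤ) :
    Module.finrank ℂ (D.SKhOfWeight k) ≤ Module.finrank ℂ (D.SKhOfWeight (-k)) := by
  have hmem : ∀ y ∈ D.SKhOfWeight k,
      homologyMap D.reverseMap reverseMap_suturedDifferential y ∈ D.SKhOfWeight (-k) := by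
    intro y hy
    obtain ⟨x, hk, hx, rfl⟩ := mem_SKhOfWeight_iff.1 hy
    refine mem_SKhOfWeight_iff.2 ⟨D.reverseMap x, ?_, _, rfl⟩
    rw [mem_chainsOfWeight_iff] at hk ⊢
    rw [gradingMap_reverseMap, hk, map_smul, Int.cast_neg, neg_smul]
  refine LinearMap.finrank_le_finrank_of_injective
    (f := (homologyMap D.reverseMap reverseMap_suturedDifferential).restrict hmem) ?_
  have hinj : Injective (homologyMap D.reverseMap reverseMap_suturedDifferential) := by
    refine LeftInverse.injective
      (g := homologyMap D.reverseMap reverseMap_suturedDifferential) fun y => ?_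
    obtain ⟨x, hx, rfl⟩ := exists_homologyClass y
    simp only [homologyMap_homologyClass, reverseMap_reverseMap]
  intro y z h
  exact Subtype.ext (hinj (congrArg Subtype.val h))

theorem finrank_SKhOfWeight_abs (k : ℤ) :
    Module.finrank ℂ (D.SKhOfWeight |k|) = Module.finrank ℂ (D.SKhOfWeight k) := by
  rcases abs_choice k with h | h <;> rw [h]
  refine le_antisymm ?_ (finrank_SKhOfWeight_le_neg k)
  have := finrank_SKhOfWeight_le_neg (D := D) (-k)
  rwa [neg_neg] at this

theorem finrank_SKhOfWeight_add_le {k : ℤ} (hk : 0 ≤ k) (n : ℕ) :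
    Module.finrank ℂ (D.SKhOfWeight (k + 2 * n)) ≤ Module.finrank ℂ (D.SKhOfWeight k) := by
  induction n with
  | zero => rw [Nat.cast_zero, mul_zero, add_zero]
  | succ n ih =>
    refine (finrank_SKhOfWeight_le_sub_two (by omega)).trans (le_of_eq_of_le ?_ ih)
    rw [show k + 2 * ((n + 1 : ℕ) : ℤ) - 2 = k + 2 * n by push_cast; ring]

end AnnularDiagram

end

theorem corollary5p1 (L : AnnularLink) (D : AnnularDiagram) (hD : D.IsDiagramOf L)
    (k k' : ℤ) (hmod : k ≡ k' [ZMOD 2]) (habs : |k| ≤ |k'|) :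
    Module.finrank ℂ (D.SKhOfWeight k') ≤ Module.finrank ℂ (D.SKhOfWeight k) := by
  rw [← AnnularDiagram.finrank_SKhOfWeight_abs k, ← AnnularDiagram.finrank_SKhOfWeight_abs k']
  have hmod' : |k| % 2 = |k'| % 2 := by
    rw [Int.ModEq] at hmod
    rcases abs_choice k with h | h <;> rcases abs_choice k' with h' | h' <;> rw [h, h'] <;> omega
  obtain ⟨n, hn⟩ : ∃ n : ℕ, |k'| = |k| + 2 * n := ⟨((|k'| - |k|) / 2).toNat, by omega⟩
  rw [hn]
  exact AnnularDiagram.finrank_SKhOfWeight_add_le (abs_nonneg k) n
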